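/- **Setting.** A non-stationary episodic MDP has $S\ge 1$ states, $A\ge 1$ actions, $M\ge1$ episodes and $H\ge1$ steps per episode; $T=MH$. When action $a$ is taken in state $s$ at step $h$ of episode $m$, a random reward $R_h^m(s,a)\in[0,1]$ with mean $r_h^m(s,a)$ is received and the next state has law $P_h^m(\cdot\mid s,a)$ (the reward and the next state may be dependent); given the present state and action, this outcome is independent of the past. The initial states $s_1^1,\dots,s_1^M$ are fixed in advance. For a policy $\pi$, $V_h^{m,\pi}(s)$ is the expected sum of the mean rewards over steps $h,\dots,H$ of episode $m$ from state $s$, and $V_h^{m,\star}=\sup_\pi V_h^{m,\pi}$. The variation budgets are $$\Delta_r=\sum_{m=1}^{M-1}\sum_{h=1}^H\sup_{s,a}|r_h^m(s,a)-r_h^{m+1}(s,a)|,\qquad \Delta_p=\sum_{m=1}^{M-1}\sum_{h=1}^H\sup_{s,a}\|P_h^m(\cdot\mid s,a)-P_h^{m+1}(\cdot\mid s,a)\|_1,\qquad \Delta=\Delta_r+\Delta_p .$$ **Algorithm (RestartQ-UCB with Hoeffding bonuses, known local budgets, confidence input $\delta'$).** Put $D=S^{-1/3}A^{-1/3}\Delta^{2/3}H^{-2/3}T^{1/3}$,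 $K=\lceil M/D\rceil$ and $\iota=\log(2/\delta')$. The episodes are divided into consecutive epochs of $K$ episodes (the last one may be shorter). Let $\Delta_r^{(d)},\Delta_p^{(d)}$ be the variations, defined as above, between consecutive episodes inside epoch $d$, and $b_\Delta=\Delta_r^{(d)}+H\Delta_p^{(d)}$ during epoch $d$. Let $e_1=H$, $e_{i+1}=\lfloor(1+\frac1H)e_i\rfloor$ and $\mathcal L=\{\sum_{i=1}^je_i: j\ge1\}$. At the start of each epoch set, for all $s,a,h$, $Q_h(s,a)=V_h(s)=H-h+1$, $V_{H+1}=0$ and $N_h=\check N_h=\check r_h=\check v_h=0$. At step $h$ of an episode, in state $s_h$, take $a_h\in\arg\max_aQ_h(s_h,a)$ (ties broken by any measurable rule), receive the reward $R$, observe $s_{h+1}$, and at $(s_h,a_h)$ increase $\check r_h$ by $R$, $\check v_h$ by $V_{h+1}(s_{h+1})$, and $N_h$ and $\check N_h$ by $1$. If then $N_h(s_h,a_h)\in\mathcal L$, write $\check n=\check N_h(s_h,a_h)$ and set $$Q_h(s_h,a_h)\gets\min\Big\{\tfrac{\check r_h(s_h,a_h)}{\check n}+\tfrac{\check v_h(s_h,a_h)}{\check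 n}+\sqrt{\tfrac{H^2}{\check n}\iota}+\sqrt{\tfrac1{\check n}\iota}+2b_\Delta,\;Q_h(s_h,a_h)\Big\},\qquad V_h(s_h)\gets\max_aQ_h(s_h,a),$$ and reset $\check N_h,\check r_h,\check v_h$ at $(s_h,a_h)$ to $0$. Let $\pi$ be the resulting policy (in episode $m$: greedy with respect to the $Q$ at the beginning of that episode) and let its dynamic regret be $\mathcal R(\pi,M)=\sum_{m=1}^M\big(V_1^{m,\star}(s_1^m)-V_1^{m,\pi}(s_1^m)\big)$. **Theorem.** There is a universal integer $p\ge0$, and for every $c>0$ a constant $C>0$ depending only on $c$, such that the following holds for all such MDPs, all initial states, all tie-breaking rules and all $\delta\in(0,1)$. If $T\ge c\,SA\Delta H^2$ and $D\ge1$, then RestartQ-UCB with Hoeffding bonuses, run with confidence input $\delta'=\delta/(SAT)$, satisfies with probability at least $1-\delta$ $$\mathcal R(\pi,M)\;\le\;C\,\Big(\log\frac{2SAT}{\delta}\Big)^{p}\,S^{1/3}A^{1/3}\Delta^{1/3}H^{5/3}T^{2/3}.$$ -/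

import Mathlib

open MeasureTheory

noncomputable section

/-- A non-stationary episodic MDP with state set `Fin S` and action set `Fin A`.
Episodes and steps are numbered from `0`: the pair `(m, h)` is step `h + 1` of episode `m + 1`;
only `m < M` and `h < H` matter for `M` episodes of `H` steps.
`outcome m h s a` is the joint law of the random reward and the next state when action `a` is taken
in state `s` at time `(m, h)`; rewards lie in `[0, 1]`. -/
structure NonstationaryMDP (S A : ℕ) where
  outcome : ℕ → ℕ → Fin S → Fin A → ProbabilityMeasure (ℝ × Fin S)
  reward_mem : ∀ m h s a,
    ∀ᵐ x ∂(outcome m h s a : Measure (ℝ × Fin S)), x.1 ∈ Set.Icc (0 : ℝ) 1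

namespace NonstationaryMDP

variable {S A : ℕ} (env : NonstationaryMDP S A)

/-- Mean reward `r_h^m(s, a)`. -/
def r (m h : ℕ) (s : Fin S) (a : Fin A) : ℝ :=
  ∫ x, x.1 ∂(env.outcome m h s a : Measure (ℝ × Fin S))

/-- Transition probability `P_h^m(s' ∣ s, a)`. -/
def P (m h : ℕ) (s : Fin S) (a : Fin A) (s' : Fin S) : ℝ :=
  (env.outcome m h s a : Measure (ℝ × Fin S)).real {x | x.2 = s'}

/-- Law of the state reached `j` steps after being in state `s` at step `h` of episode `m`, when the
policy `π` is followed under the transition kernels of episode `m`. -/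
def stateDist (m : ℕ) (π : ℕ → Fin S → Fin A) (h : ℕ) (s : Fin S) : ℕ → Fin S → ℝ
  | 0 => fun s' => if s' = s then 1 else 0
  | j + 1 => fun s' => ∑ x, stateDist m π h s j x * env.P m (h + j) x (π (h + j) x) s'

/-- `V_h^{m,π}(s)`: the expected sum of the mean rewards from step `h` to the end of episode `m`
under the policy `π`, starting from `s` at step `h`. -/
def value (H m : ℕ) (π : ℕ → Fin S → Fin A) (h : ℕ) (s : Fin S) : ℝ :=
  ∑ j ∈ Finset.range (H - h),
    ∑ x, env.stateDist m π h s j x * env.r m (h + j) x (π (h + j) x)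

/-- `V_h^{m,⋆}(s)`: the optimal value in episode `m`. -/
def optValue (H m h : ℕ) (s : Fin S) : ℝ :=
  ⨆ π : ℕ → Fin S → Fin A, env.value H m π h s

/-- Variation of the mean rewards between episodes `m` and `m + 1`, summed over the steps. -/
def rewardStep (H m : ℕ) : ℝ :=
  ∑ h ∈ Finset.range H,
    ⨆ p : Fin S × Fin A, |env.r m h p.1 p.2 - env.r (m + 1) h p.1 p.2|

/-- `L¹` variation of the transition kernels between episodes `m` and `m + 1`, summed over the
steps. -/
def transStep (H m : ℕ) : ℝ :=
  ∑ h ∈ Finset.range H,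
    ⨆ p : Fin S × Fin A, ∑ s', |env.P m h p.1 p.2 s' - env.P (m + 1) h p.1 p.2 s'|

/-- The total variation budget `Δ = Δ_r + Δ_p` over `M` episodes. -/
def variation (H M : ℕ) : ℝ :=
  ∑ m ∈ Finset.range (M - 1), env.rewardStep H m + ∑ m ∈ Finset.range (M - 1), env.transStep H m

/-- Local variation budget `Δ_r^{(d)}` of the epoch with episodes `d K ≤ m < min ((d + 1) K) M`. -/
def localReward (H M K d : ℕ) : ℝ :=
  ∑ m ∈ Finset.Ico (d * K) (min ((d + 1) * K) M - 1), env.rewardStep H m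

/-- Local variation budget `Δ_p^{(d)}` of the same epoch. -/
def localTrans (H M K d : ℕ) : ℝ :=
  ∑ m ∈ Finset.Ico (d * K) (min ((d + 1) * K) M - 1), env.transStep H m

/-- The bonus `b_Δ = Δ_r^{(d)} + H Δ_p^{(d)}` of epoch `d`. -/
def bonusDelta (H M K d : ℕ) : ℝ :=
  env.localReward H M K d + H * env.localTrans H M K d

/-- `D = S^{-1/3} A^{-1/3} Δ^{2/3} H^{-2/3} T^{1/3}` with `T = M H`. -/
def epochs (H M : ℕ) : ℝ :=
  (S : ℝ) ^ (-(1 / 3) : ℝ) * (A : ℝ) ^ (-(1 / 3) : ℝ) * env.variation H M ^ (2 / 3 : ℝ) *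
    (H : ℝ) ^ (-(2 / 3) : ℝ) * ((M : ℝ) * H) ^ (1 / 3 : ℝ)

/-- The number `K = ⌈M / D⌉` of episodes in an epoch. -/
def epochLength (H M : ℕ) : ℕ := ⌈(M : ℝ) / env.epochs H M⌉₊

/-- The environment's randomness: an independent table of pairs
`ω (m, h, s, a) = (R_h^m(s, a), next state)`, each with law `outcome m h s a`. -/
def noise : Measure (ℕ × ℕ × Fin S × Fin A → ℝ × Fin S) :=
  Measure.infinitePi fun i => (env.outcome i.1 i.2.1 i.2.2.1 i.2.2.2 : Measure (ℝ × Fin S))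

end NonstationaryMDP

/-- The lengths of the stages: `e_1 = H`, `e_{i+1} = ⌊(1 + 1/H) e_i⌋` (here from index `0`). -/
def stageLength (H : ℕ) : ℕ → ℕ
  | 0 => H
  | i + 1 => ⌊(1 + 1 / (H : ℝ)) * stageLength H i⌋₊

/-- The set `𝓛` of the ending times of the stages. -/
def stageEnds (H : ℕ) : Set ℕ :=
  {n | ∃ j, n = ∑ i ∈ Finset.range (j + 1), stageLength H i}

/-- The variables of the algorithm; `cN`, `cr`, `cv` are the per-stage quantities
`Ň`, `ř`, `v̌`. -/
structure Memory (S A : ℕ) where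
  Q : ℕ → Fin S → Fin A → ℝ
  V : ℕ → Fin S → ℝ
  N : ℕ → Fin S → Fin A → ℕ
  cN : ℕ → Fin S → Fin A → ℕ
  cr : ℕ → Fin S → Fin A → ℝ
  cv : ℕ → Fin S → Fin A → ℝ

/-- `f` with its value at `(h, s, a)` replaced by `y`. -/
def setAt {S A : ℕ} {β : Type} (f : ℕ → Fin S → Fin A → β) (h : ℕ) (s : Fin S) (a : Fin A) (y : β) :
    ℕ → Fin S → Fin A → β :=
  fun h' s' a' => if h' = h ∧ s' = s ∧ a' = a then y else f h' s' a'

namespace Memory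

variable {S A : ℕ}

/-- Initialization at the start of an epoch. Steps being numbered from `0`, the initial value
`H - h + 1` of the `h`-th step is `H - h` here, and `V H = 0`. -/
def init (S A H : ℕ) : Memory S A where
  Q := fun h _ _ => (H : ℝ) - h
  V := fun h _ => (H : ℝ) - h
  N := fun _ _ _ => 0
  cN := fun _ _ _ => 0
  cr := fun _ _ _ => 0
  cv := fun _ _ _ => 0

open Classical in
/-- The updates made after action `a` in state `s` at step `h` gave reward `R` and next state `s'`,
with Hoeffding bonus `b_h` and extra bonus `2 b_Δ`. -/
def step (H : ℕ) (ι bΔ : ℝ) (h : ℕ) (s : Fin S) (a : Fin A) (R : ℝ) (s' : Fin S)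
    (mem : Memory S A) : Memory S A :=
  let n := mem.N h s a + 1
  let cn := mem.cN h s a + 1
  let cr' := mem.cr h s a + R
  let cv' := mem.cv h s a + mem.V (h + 1) s'
  if n ∈ stageEnds H then
    let b := √((H : ℝ) ^ 2 / cn * ι) + √(1 / cn * ι)
    let Q' := setAt mem.Q h s a (min (cr' / cn + cv' / cn + b + 2 * bΔ) (mem.Q h s a))
    { Q := Q'
      V := fun k x => if k = h ∧ x = s then ⨆ a', Q' h s a' else mem.V k x
      N := setAt mem.N h s a n
      cN := setAt mem.cN h s a 0
      cr := setAt mem.cr h s a 0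
      cv := setAt mem.cv h s a 0 }
  else
    { mem with
      N := setAt mem.N h s a n
      cN := setAt mem.cN h s a cn
      cr := setAt mem.cr h s a cr'
      cv := setAt mem.cv h s a cv' }

end Memory

/-- A rule for choosing a maximizer of `Q_h(s, ·)`: ties are broken in any measurable way, which may
depend on the episode, the step and the state. -/
structure GreedyRule (S A : ℕ) where
  pick : ℕ → ℕ → Fin S → (Fin A → ℝ) → Fin A
  measurable_pick : ∀ m h s, Measurable (pick m h s)
  le_pick : ∀ m h s (q : Fin A → ℝ) (a : Fin A), q a ≤ q (pick m h s q)

namespace RestartQUCB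

variable {S A : ℕ} (env : NonstationaryMDP S A) (g : GreedyRule S A)

/-- Memory and current state after `h` steps of episode `m`, started with memory `mem` in state
`s₁`, on the sample point `ω`. -/
def play (H : ℕ) (ι bΔ : ℝ) (ω : ℕ × ℕ × Fin S × Fin A → ℝ × Fin S) (m : ℕ)
    (mem : Memory S A) (s₁ : Fin S) : ℕ → Memory S A × Fin S
  | 0 => (mem, s₁)
  | h + 1 =>
    let c := play H ι bΔ ω m mem s₁ h
    let a := g.pick m h c.2 (c.1.Q h c.2)
    let x := ω (m, h, c.2, a)
    (c.1.step H ι bΔ h c.2 a x.1 x.2, x.2)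

/-- Memory of RestartQ-UCB (Hoeffding) at the beginning of episode `m`, after a possible restart.
The confidence input is `δ'`, so `ι = log (2 / δ')`; episode `m` lies in epoch `m / K`. -/
def memAt (H M : ℕ) (δ' : ℝ) (s₁ : ℕ → Fin S) (ω : ℕ × ℕ × Fin S × Fin A → ℝ × Fin S) :
    ℕ → Memory S A
  | 0 => Memory.init S A H
  | m + 1 =>
    let K := env.epochLength H M
    if K ∣ m + 1 then Memory.init S A H
    else (play g H (Real.log (2 / δ')) (env.bonusDelta H M K (m / K)) ω m
      (memAt H M δ' s₁ ω m) (s₁ m) H).1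

/-- The policy followed in episode `m`: greedy for the `Q`-values at the beginning of the episode
(`Q_h` changes during an episode only after step `h` has been played). -/
def policy (H M : ℕ) (δ' : ℝ) (s₁ : ℕ → Fin S) (ω : ℕ × ℕ × Fin S × Fin A → ℝ × Fin S)
    (m h : ℕ) (s : Fin S) : Fin A :=
  g.pick m h s ((memAt env g H M δ' s₁ ω m).Q h s)

/-- The dynamic regret over `M` episodes with initial states `s₁ 0, …, s₁ (M - 1)`. -/
def regret (H M : ℕ) (δ' : ℝ) (s₁ : ℕ → Fin S) (ω : ℕ × ℕ × Fin S × Fin A → ℝ × Fin S) : ℝ :=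
  ∑ m ∈ Finset.range M,
    (env.optValue H m 0 (s₁ m) - env.value H m (policy env g H M δ' s₁ ω m) 0 (s₁ m))

end RestartQUCB

end

/-! The argument is optimism plus a telescoping recursion over the steps of an episode, with a
balance between drift inside an epoch and the cost of restarting.

Drift: inside one epoch any two optimal action values differ by at most `b_Δ` (`abs_optQ_sub_le`).
The samples of a stage, with the algorithm's `V` replaced by the true `V⋆`, are independent of the
past given the visited pair and range over an interval of length `H + 1`. By Azuma–Hoeffding
(`noise_tail`) their average over a stage of length `e` is therefore within `(H + 1) √(ι / e) + b_Δ`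
of `Q⋆` of any later episode of the epoch. The event `Good` collects these bounds together with one
martingale bound per step for the policy gaps.

Optimism: by `Run.invariant`, `Q` is the minimum of its initial value and the estimates of the
finished stages. The bonus dominates the deviation, so backward induction on the step gives `V⋆ ≤ V`
on `Good` (`optValue_le_V`). Hence the regret is at most the sum over episodes of the shortfall `V -
V^π` at the first step.

Recursion: the same bounds show that `Q - Q⋆` at a visit is at most `3 b_Δ`, plus twice the
Hoeffding bonus, plus the average of `V - V⋆` at the next step over the previous stage; in a first
stage `H` suffices (`Q_sub_optQ_le`). Summed over episodes, each sample of a stage is reused by the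
visits of the next one, which is longer by a factor at most `1 + 1/H` (`sum_stage_ratio_le`). Thus
the total shortfall at step `h` is at most `B + (1 + 1/H)` times the total at `h + 1`
(`sum_shortfall_step`), and `(1 + 1/H)^H ≤ 3` gives `3 H B`.

Balance: `B` contains drift of order `(M / D) H Δ`, first stages costing `D S A H²`, Hoeffding
bonuses summed by Cauchy–Schwarz, and a martingale term. The choice of `D` brings the first and
third to the claimed order; the lower bound on `T` controls the second and `D ≥ 1` the last
(`regret_terms_le`). -/

noncomputable section

/-! ### Stages -/

/-- The number of visits before the stage `j` starts. -/
def stageStart (H j : ℕ) : ℕ := ∑ i ∈ Finset.range j, stageLength H i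

theorem stageLength_succ (H i : ℕ) (hH : 0 < H) :
    stageLength H (i + 1) = stageLength H i + ⌊(stageLength H i : ℝ) / H⌋₊ := by
  have h : (1 + 1 / (H : ℝ)) * stageLength H i
      = (stageLength H i : ℝ) / H + (stageLength H i : ℕ) := by ring
  rw [stageLength, h, Nat.floor_add_natCast (by positivity), add_comm]

theorem le_stageLength (H i : ℕ) (hH : 0 < H) : H ≤ stageLength H i := by
  induction i with
  | zero => exact le_rfl
  | succ i ih => rw [stageLength_succ H i hH]; omega

theorem stageLength_pos (H i : ℕ) (hH : 0 < H) : 0 < stageLength H i :=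
  hH.trans_le (le_stageLength H i hH)

theorem stageLength_succ_le (H i : ℕ) :
    (stageLength H (i + 1) : ℝ) ≤ (1 + 1 / (H : ℝ)) * stageLength H i := by
  rw [stageLength]; exact Nat.floor_le (by positivity)

theorem stageStart_succ (H j : ℕ) : stageStart H (j + 1) = stageStart H j + stageLength H j :=
  Finset.sum_range_succ _ _

theorem stageStart_strictMono (H : ℕ) (hH : 0 < H) : StrictMono (stageStart H) :=
  strictMono_nat_of_lt_succ fun j => by
    rw [stageStart_succ]; have := stageLength_pos H j hH; omega

theorem mem_stageEnds {H n : ℕ} : n ∈ stageEnds H ↔ ∃ j, n = stageStart H (j + 1) := Iff.rfl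

/-- Since `e_j ≥ H`, the floor in `e_{j+1} - e_j = ⌊e_j / H⌋` loses at most a factor two, so each
increment is at least `e_j / (2 H)`; telescoping bounds the sum of the lengths. -/
theorem stageStart_le (H j : ℕ) (hH : 0 < H) :
    (stageStart H j : ℝ) ≤ 2 * H * stageLength H j := by
  have hH' : (0 : ℝ) < H := by exact_mod_cast hH
  induction j with
  | zero => simp [stageStart]; positivity
  | succ j ih =>
    have h1 : (1 : ℝ) ≤ (stageLength H j : ℝ) / H := by
      rw [le_div_iff₀ hH', one_mul]; exact_mod_cast le_stageLength H j hH
    have h2 : (stageLength H j : ℝ) / H ≤ 2 * (⌊(stageLength H j : ℝ) / H⌋₊ : ℝ) := by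
      have h3 := Nat.lt_floor_add_one ((stageLength H j : ℝ) / H)
      have h4 : (1 : ℝ) ≤ (⌊(stageLength H j : ℝ) / H⌋₊ : ℝ) := by
        exact_mod_cast Nat.one_le_floor_iff _ |>.2 h1
      linarith
    rw [div_le_iff₀ hH'] at h2
    rw [stageStart_succ, stageLength_succ H j hH]
    push_cast
    nlinarith

/-- A visit in stage `j + 1` has rank below `stageStart H (j + 2)`. This converts the bonus scale `1
/ √e_j`, which uses the preceding stage, into the inverse square root of the rank. -/
theorem stageStart_add_two_le (H j : ℕ) (hH : 0 < H) :
    (stageStart H (j + 2) : ℝ) ≤ 5 * H * stageLength H j := by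
  have h1 := stageStart_le H j hH
  have h2 := stageLength_succ_le H j
  have hH' : (1 : ℝ) ≤ H := by exact_mod_cast hH
  have h3 : 1 / (H : ℝ) ≤ 1 := by rw [div_le_one (by linarith)]; exact hH'
  have h4 : (0 : ℝ) ≤ stageLength H j := Nat.cast_nonneg _
  rw [stageStart_succ, stageStart_succ]
  push_cast
  nlinarith

open Classical in
/-- The stage in which a state-action pair is after `n` visits. -/
def stageIndex (H n : ℕ) : ℕ := Nat.count (· ∈ stageEnds H) (n + 1)

theorem stageIndex_zero (H : ℕ) (hH : 0 < H) : stageIndex H 0 = 0 := by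
  classical
  have : (0 : ℕ) ∉ stageEnds H := by
    rintro ⟨j, hj⟩
    have := stageStart_strictMono H hH (Nat.succ_pos j)
    change 0 = stageStart H (j + 1) at hj
    have h0 : stageStart H 0 = 0 := Finset.sum_range_zero _
    rw [Nat.succ_eq_add_one] at this
    omega
  simp [stageIndex, Nat.count_succ, this]

open Classical in
theorem stageIndex_succ (H n : ℕ) :
    stageIndex H (n + 1) = stageIndex H n + if n + 1 ∈ stageEnds H then 1 else 0 :=
  Nat.count_succ _ _

open Classical in
theorem stageIndex_mono (H : ℕ) : Monotone (stageIndex H) :=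
  fun _ _ h => Nat.count_monotone _ (Nat.succ_le_succ h)

theorem stageIndex_spec (H n : ℕ) (hH : 0 < H) :
    stageStart H (stageIndex H n) ≤ n ∧ n < stageStart H (stageIndex H n + 1) := by
  have hm := stageStart_strictMono H hH
  induction n with
  | zero =>
    rw [stageIndex_zero H hH]
    exact ⟨by simp [stageStart], by simpa [stageStart] using stageLength_pos H 0 hH⟩
  | succ n ih =>
    rw [stageIndex_succ]
    split_ifs with h
    · obtain ⟨j, hj⟩ := mem_stageEnds.1 h
      have h1 : stageIndex H n = j := by
        have h2 : stageStart H (stageIndex H n) < stageStart H (j + 1) := by omega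
        have h3 : stageStart H (j + 1) ≤ stageStart H (stageIndex H n + 1) := by omega
        have h4 := hm.lt_iff_lt.1 h2
        have h5 := hm.le_iff_le.1 h3
        omega
      rw [h1, ← hj]
      exact ⟨le_rfl, hj ▸ hm (Nat.lt_succ_self _)⟩
    · have h1 : n + 1 ≠ stageStart H (stageIndex H n + 1) := fun h2 => h (mem_stageEnds.2 ⟨_, h2⟩)
      simp only [add_zero]
      omega

theorem stageIndex_eq_iff (H n j : ℕ) (hH : 0 < H) :
    stageIndex H n = j ↔ stageStart H j ≤ n ∧ n < stageStart H (j + 1) := by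
  have hm := stageStart_strictMono H hH
  have hs := stageIndex_spec H n hH
  constructor
  · rintro rfl; exact hs
  · rintro ⟨h1, h2⟩
    have h3 := hm.lt_iff_lt.1 (hs.1.trans_lt h2)
    have h4 := hm.lt_iff_lt.1 (h1.trans_lt hs.2)
    omega

/-- The number of visits in stage `j` among the first `n`. -/
theorem card_stage_le (H n j : ℕ) (hH : 0 < H) :
    (∑ k ∈ Finset.range n, if stageIndex H k = j then 1 else 0) ≤ stageLength H j := by
  rw [← Finset.card_filter]
  calc _ ≤ (Finset.Ico (stageStart H j) (stageStart H (j + 1))).card := by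
        apply Finset.card_le_card
        intro k hk
        simpa [stageIndex_eq_iff H k j hH] using (Finset.mem_filter.1 hk).2
    _ = _ := by rw [Nat.card_Ico, stageStart_succ]; omega

theorem card_stage_eq (H n j : ℕ) (hH : 0 < H) (hj : j < stageIndex H n) :
    (∑ k ∈ Finset.range n, if stageIndex H k = j then 1 else 0) = stageLength H j := by
  rw [← Finset.card_filter]
  have : (Finset.range n).filter (fun k => stageIndex H k = j) =
      Finset.Ico (stageStart H j) (stageStart H (j + 1)) := by
    ext k
    simp only [Finset.mem_filter, Finset.mem_range, Finset.mem_Ico, stageIndex_eq_iff H k j hH]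
    have h1 := (stageIndex_spec H n hH).1
    have h2 := (stageStart_strictMono H hH).monotone (show j + 1 ≤ stageIndex H n from hj)
    constructor
    · exact fun h => h.2
    · exact fun h => ⟨by omega, h⟩
  rw [this, Nat.card_Ico, stageStart_succ]; omega

/-- Summation over the times at which `p` holds, indexed by their ranks. -/
theorem sum_rank {E : Type*} [AddCommMonoid E] (p : ℕ → Prop) [DecidablePred p] (f : ℕ → E)
    (n : ℕ) :
    (∑ l ∈ Finset.range n, if p l then f (Nat.count p l) else 0) =
      ∑ k ∈ Finset.range (Nat.count p n), f k := by
  induction n with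
  | zero => simp
  | succ n ih =>
    rw [Finset.sum_range_succ, ih, Nat.count_succ]
    split_ifs with h
    · rw [Finset.sum_range_succ]
    · simp

theorem sum_inv_sqrt_le (n : ℕ) :
    (∑ k ∈ Finset.range n, 1 / √((k : ℝ) + 1)) ≤ 2 * √(n : ℝ) := by
  induction n with
  | zero => simp
  | succ n ih =>
    rw [Finset.sum_range_succ]
    have h0 : 0 < √((n : ℝ) + 1) := by positivity
    have h1 : √((n : ℝ) + 1) ^ 2 = n + 1 := Real.sq_sqrt (by positivity)
    have h2 : √(n : ℝ) ^ 2 = n := Real.sq_sqrt (by positivity)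
    have h3 : 1 / √((n : ℝ) + 1) ≤ 2 * (√((n : ℝ) + 1) - √(n : ℝ)) := by
      rw [div_le_iff₀ h0]
      nlinarith [sq_nonneg (√((n : ℝ) + 1) - √(n : ℝ))]
    push_cast
    linarith

/-- The sum of the bonus scale `1 / √e` over the first `n` visits. -/
theorem sum_stage_bonus_le (H n : ℕ) (hH : 0 < H) :
    (∑ k ∈ Finset.range n, if stageIndex H k = 0 then (0 : ℝ)
        else 1 / √(stageLength H (stageIndex H k - 1) : ℝ)) ≤ 2 * √(5 * H) * √(n : ℝ) := by
  calc _ ≤ ∑ k ∈ Finset.range n, √(5 * H) * (1 / √((k : ℝ) + 1)) := by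
        apply Finset.sum_le_sum
        intro k _
        split_ifs with h
        · positivity
        · have h1 := (stageIndex_spec H k hH).2
          obtain ⟨j, hj⟩ := Nat.exists_eq_succ_of_ne_zero h
          rw [hj] at h1 ⊢
          have h2 := stageStart_add_two_le H j hH
          have h3 : ((k : ℝ) + 1) ≤ 5 * H * stageLength H j :=
            le_trans (by exact_mod_cast h1) h2
          have h4 : √((k : ℝ) + 1) ≤ √(5 * H) * √(stageLength H j : ℝ) := by
            rw [← Real.sqrt_mul (by positivity)]; exact Real.sqrt_le_sqrt h3
          have h5 : (0 : ℝ) < stageLength H j := by exact_mod_cast stageLength_pos H j hH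
          have h6 : 0 < √(stageLength H j : ℝ) := Real.sqrt_pos.2 h5
          have h7 : 0 < √((k : ℝ) + 1) := by positivity
          simp only [Nat.succ_eq_add_one, Nat.add_sub_cancel]
          rw [mul_one_div, div_le_div_iff₀ h6 h7]
          linarith
    _ = √(5 * H) * ∑ k ∈ Finset.range n, 1 / √((k : ℝ) + 1) := by rw [Finset.mul_sum]
    _ ≤ √(5 * H) * (2 * √(n : ℝ)) := by gcongr; exact sum_inv_sqrt_le n
    _ = _ := by ring

namespace NonstationaryMDP

variable {S A : ℕ} (env : NonstationaryMDP S A)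

/-! ### Mean rewards and transition probabilities -/

theorem r_mem (m h : ℕ) (s : Fin S) (a : Fin A) : env.r m h s a ∈ Set.Icc (0 : ℝ) 1 := by
  have h0 := env.reward_mem m h s a
  have hi : Integrable (fun x : ℝ × Fin S => x.1) (env.outcome m h s a : Measure (ℝ × Fin S)) :=
    Integrable.of_mem_Icc 0 1 measurable_fst.aemeasurable h0
  constructor
  · exact integral_nonneg_of_ae (h0.mono fun x hx => hx.1)
  · have := integral_mono_ae hi (integrable_const (1 : ℝ)) (h0.mono fun x hx => hx.2)
    simpa [r] using this

theorem P_nonneg (m h : ℕ) (s : Fin S) (a : Fin A) (s' : Fin S) : 0 ≤ env.P m h s a s' :=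
  measureReal_nonneg

theorem integral_next (m h : ℕ) (s : Fin S) (a : Fin A) (f : Fin S → ℝ) :
    ∫ x, f x.2 ∂(env.outcome m h s a : Measure (ℝ × Fin S)) = ∑ s', env.P m h s a s' * f s' := by
  have h1 : ∀ x : ℝ × Fin S, f x.2 = ∑ s', Set.indicator {x : ℝ × Fin S | x.2 = s'}
      (fun _ => f s') x := by
    intro x
    simp [Set.indicator_apply]
  have hm : ∀ s', MeasurableSet {x : ℝ × Fin S | x.2 = s'} := fun s' =>
    measurable_snd (measurableSet_singleton s')
  simp_rw [h1]
  rw [integral_finsetSum _ fun s' _ => (integrable_const (f s')).indicator (hm s')]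
  refine Finset.sum_congr rfl fun s' _ => ?_
  rw [integral_indicator (hm s')]
  simp [P]

theorem sum_P (m h : ℕ) (s : Fin S) (a : Fin A) : ∑ s', env.P m h s a s' = 1 := by
  have := env.integral_next m h s a fun _ => 1
  simpa using this.symm

theorem sum_P_mul_le (m h : ℕ) (s : Fin S) (a : Fin A) {f g : Fin S → ℝ} (hfg : ∀ x, f x ≤ g x) :
    ∑ s', env.P m h s a s' * f s' ≤ ∑ s', env.P m h s a s' * g s' :=
  Finset.sum_le_sum fun x _ => mul_le_mul_of_nonneg_left (hfg x) (env.P_nonneg m h s a x)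

theorem sum_P_const (m h : ℕ) (s : Fin S) (a : Fin A) (c : ℝ) :
    ∑ s', env.P m h s a s' * c = c := by
  rw [← Finset.sum_mul, sum_P, one_mul]

/-! ### Bellman equations -/

/-- `stateDist` is defined by appending a last step; the Bellman equation needs the first step split
off instead. -/
theorem stateDist_succ (m : ℕ) (π : ℕ → Fin S → Fin A) (h : ℕ) (s : Fin S) (j : ℕ) (s' : Fin S) :
    env.stateDist m π h s (j + 1) s' =
      ∑ x, env.P m h s (π h s) x * env.stateDist m π (h + 1) x j s' := by
  induction j generalizing s' with
  | zero => simp [stateDist]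
  | succ j ih =>
    rw [stateDist]
    simp_rw [ih, stateDist, Finset.sum_mul, Finset.mul_sum]
    rw [Finset.sum_comm]
    refine Finset.sum_congr rfl fun x _ => Finset.sum_congr rfl fun y _ => ?_
    rw [show h + (j + 1) = h + 1 + j by ring]
    ring

theorem value_of_le {H m h : ℕ} (π : ℕ → Fin S → Fin A) (s : Fin S) (hh : H ≤ h) :
    env.value H m π h s = 0 := by
  simp [value, Nat.sub_eq_zero_of_le hh]

theorem value_eq {H m h : ℕ} (π : ℕ → Fin S → Fin A) (s : Fin S) (hh : h < H) :
    env.value H m π h s =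
      env.r m h s (π h s) + ∑ s', env.P m h s (π h s) s' * env.value H m π (h + 1) s' := by
  obtain ⟨k, rfl⟩ : ∃ k, H = h + 1 + k := ⟨H - (h + 1), by omega⟩
  rw [value, show h + 1 + k - h = k + 1 by omega, Finset.sum_range_succ']
  simp only [value, show h + 1 + k - (h + 1) = k by omega]
  rw [add_comm]
  congr 1
  · simp [stateDist]
  · simp_rw [stateDist_succ, Finset.sum_mul, Finset.mul_sum]
    conv_rhs => rw [Finset.sum_comm]
    refine Finset.sum_congr rfl fun j _ => ?_
    rw [Finset.sum_comm]
    refine Finset.sum_congr rfl fun x _ => Finset.sum_congr rfl fun y _ => ?_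
    rw [show h + (j + 1) = h + 1 + j by ring]
    ring

theorem value_congr {H m h : ℕ} {π π' : ℕ → Fin S → Fin A} (s : Fin S)
    (hπ : ∀ k < H, π k = π' k) : env.value H m π h s = env.value H m π' h s := by
  by_cases hh : H ≤ h
  · rw [value_of_le _ _ _ hh, value_of_le _ _ _ hh]
  · obtain ⟨k, hk⟩ : ∃ k, k = H - h := ⟨_, rfl⟩
    induction k generalizing h s with
    | zero => omega
    | succ k ih =>
      rw [value_eq _ _ _ (by omega), value_eq _ _ _ (by omega), hπ h (by omega)]
      congr 1
      refine Finset.sum_congr rfl fun x _ => ?_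
      by_cases hh' : H ≤ h + 1
      · rw [value_of_le _ _ _ hh', value_of_le _ _ _ hh']
      · rw [ih x hh' (by omega)]

/-- Optimal value with `k` steps to go. -/
def optRec (H m : ℕ) : ℕ → Fin S → ℝ
  | 0 => fun _ => 0
  | k + 1 => fun s => ⨆ a, (env.r m (H - (k + 1)) s a +
      ∑ s', env.P m (H - (k + 1)) s a s' * optRec H m k s')

/-- `Q_h^{m,⋆}(s, a)`. -/
def optQ (H m h : ℕ) (s : Fin S) (a : Fin A) : ℝ :=
  env.r m h s a + ∑ s', env.P m h s a s' * env.optValue H m (h + 1) s'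

theorem value_le_optRec (H m k : ℕ) (hk : k ≤ H) (π : ℕ → Fin S → Fin A) (s : Fin S) :
    env.value H m π (H - k) s ≤ env.optRec H m k s := by
  induction k generalizing s with
  | zero => rw [value_of_le _ _ _ (by omega), optRec]
  | succ k ih =>
    rw [value_eq _ _ _ (by omega), optRec, show H - (k + 1) + 1 = H - k by omega]
    refine le_trans ?_ (le_ciSup (Set.finite_range _).bddAbove (π (H - (k + 1)) s))
    gcongr with x
    · exact env.P_nonneg _ _ _ _ _
    · exact ih (by omega) x

/-- Choosing a maximizer in every state and step of the backward recursion gives a single policy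
optimal from all states at once, so the supremum defining `optValue` is attained and obeys the
recursion. -/
theorem exists_optimal_policy [NeZero A] (H m : ℕ) :
    ∃ π : ℕ → Fin S → Fin A, ∀ k ≤ H, ∀ s, env.value H m π (H - k) s = env.optRec H m k s := by
  choose b hb using fun (k : ℕ) (s : Fin S) => exists_eq_ciSup_of_finite
    (f := fun a : Fin A => env.r m (H - (k + 1)) s a +
      ∑ s', env.P m (H - (k + 1)) s a s' * env.optRec H m k s')
  refine ⟨fun h s => b (H - (h + 1)) s, fun k => ?_⟩
  induction k with
  | zero => intro _ s; rw [value_of_le _ _ _ (by omega), optRec]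
  | succ k ih =>
    intro hk s
    rw [value_eq _ _ _ (by omega), optRec]
    beta_reduce
    rw [← hb, show H - (k + 1) + 1 = H - k by omega]
    simp_rw [ih (by omega)]
    rw [show H - (H - k) = k by omega]

theorem optValue_sub [NeZero A] (H m k : ℕ) (hk : k ≤ H) (s : Fin S) :
    env.optValue H m (H - k) s = env.optRec H m k s := by
  obtain ⟨π, hπ⟩ := env.exists_optimal_policy H m
  apply le_antisymm
  · exact ciSup_le fun π' => env.value_le_optRec H m k hk π' s
  · rw [← hπ k hk s]
    refine le_ciSup (f := fun π' => env.value H m π' (H - k) s) ?_ π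
    exact ⟨_, by rintro _ ⟨π', rfl⟩; exact env.value_le_optRec H m k hk π' s⟩

theorem value_le_optValue [NeZero A] {H m h : ℕ} (hh : h ≤ H) (π : ℕ → Fin S → Fin A)
    (s : Fin S) : env.value H m π h s ≤ env.optValue H m h s := by
  have h1 := env.value_le_optRec H m (H - h) (by omega) π s
  rw [← env.optValue_sub H m (H - h) (by omega)] at h1
  rwa [show H - (H - h) = h by omega] at h1

theorem optValue_self [NeZero A] (H m : ℕ) (s : Fin S) : env.optValue H m H s = 0 := by
  have := env.optValue_sub H m 0 (by omega) s
  rwa [Nat.sub_zero] at this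

theorem optValue_eq [NeZero A] {H m h : ℕ} (hh : h < H) (s : Fin S) :
    env.optValue H m h s = ⨆ a, env.optQ H m h s a := by
  have h1 := env.optValue_sub H m (H - (h + 1) + 1) (by omega) s
  rw [optRec, show H - (H - (h + 1) + 1) = h by omega] at h1
  rw [h1]
  simp only [optQ]
  simp_rw [← env.optValue_sub H m (H - (h + 1)) (by omega)]
  rw [show H - (H - (h + 1)) = h + 1 by omega]

theorem value_nonneg {H m h : ℕ} (π : ℕ → Fin S → Fin A) (s : Fin S) :
    0 ≤ env.value H m π h s := by
  have hd : ∀ j s', 0 ≤ env.stateDist m π h s j s' := by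
    intro j
    induction j with
    | zero => intro s'; simp only [stateDist]; split_ifs <;> norm_num
    | succ j ih =>
      intro s'
      exact Finset.sum_nonneg fun x _ => mul_nonneg (ih x) (env.P_nonneg _ _ _ _ _)
  exact Finset.sum_nonneg fun j _ => Finset.sum_nonneg fun x _ =>
    mul_nonneg (hd j x) (env.r_mem _ _ _ _).1

theorem optValue_nonneg [NeZero A] {H m h : ℕ} (hh : h ≤ H) (s : Fin S) :
    0 ≤ env.optValue H m h s :=
  (env.value_nonneg (fun _ _ => 0) s).trans (env.value_le_optValue hh _ s)

theorem optRec_le [NeZero A] (H m k : ℕ) (s : Fin S) : env.optRec H m k s ≤ k := by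
  induction k generalizing s with
  | zero => simp [optRec]
  | succ k ih =>
    rw [optRec]
    refine ciSup_le fun a => ?_
    have h1 := (env.r_mem m (H - (k + 1)) s a).2
    have h2 := env.sum_P_mul_le m (H - (k + 1)) s a ih
    rw [sum_P_const] at h2
    push_cast
    linarith

theorem optValue_le [NeZero A] {H m h : ℕ} (hh : h ≤ H) (s : Fin S) :
    env.optValue H m h s ≤ (H : ℝ) - h := by
  have h1 := env.optRec_le H m (H - h) s
  rw [← env.optValue_sub H m (H - h) (by omega), show H - (H - h) = h by omega,
    Nat.cast_sub hh] at h1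
  exact h1

theorem optQ_le [NeZero A] {H m h : ℕ} (hh : h < H) (s : Fin S) (a : Fin A) :
    env.optQ H m h s a ≤ (H : ℝ) - h := by
  refine le_trans ?_ (env.optValue_le (m := m) hh.le s)
  rw [env.optValue_eq hh]
  exact le_ciSup (Set.finite_range _).bddAbove a

/-! ### Variation of the optimal values -/

theorem rewardStep_nonneg (H m : ℕ) : 0 ≤ env.rewardStep H m :=
  Finset.sum_nonneg fun _ _ => Real.iSup_nonneg fun _ => abs_nonneg _

theorem transStep_nonneg (H m : ℕ) : 0 ≤ env.transStep H m :=
  Finset.sum_nonneg fun _ _ => Real.iSup_nonneg fun _ => Finset.sum_nonneg fun _ _ => abs_nonneg _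

theorem abs_ciSup_sub_ciSup_le {ι : Type*} [Finite ι] [Nonempty ι] (f g : ι → ℝ) (c : ℝ)
    (hfg : ∀ i, |f i - g i| ≤ c) : |(⨆ i, f i) - ⨆ i, g i| ≤ c := by
  rw [abs_sub_le_iff]
  constructor <;> rw [sub_le_iff_le_add] <;> refine ciSup_le fun i => ?_
  · have := le_ciSup (Set.finite_range g).bddAbove i
    linarith [(abs_sub_le_iff.1 (hfg i)).1]
  · have := le_ciSup (Set.finite_range f).bddAbove i
    linarith [(abs_sub_le_iff.1 (hfg i)).2]

/-- Variation of rewards and transitions between episodes `m` and `m + 1` at step `h`. -/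
def stepVariation (H m h : ℕ) : ℝ :=
  (⨆ p : Fin S × Fin A, |env.r m h p.1 p.2 - env.r (m + 1) h p.1 p.2|) +
    H * ⨆ p : Fin S × Fin A, ∑ s', |env.P m h p.1 p.2 s' - env.P (m + 1) h p.1 p.2 s'|

theorem stepVariation_nonneg (H m h : ℕ) : 0 ≤ env.stepVariation H m h :=
  add_nonneg (Real.iSup_nonneg fun _ => abs_nonneg _) <| mul_nonneg (Nat.cast_nonneg _) <|
    Real.iSup_nonneg fun _ => Finset.sum_nonneg fun _ _ => abs_nonneg _

/-- The difference splits into a change of reward, a change of kernel acting on `V⋆ ∈ [0, H]`, and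
the new kernel averaging the change of `V⋆`. -/
theorem abs_optQ_sub_succ_le_aux [NeZero A] {H m h : ℕ} (hh : h < H) {c : ℝ}
    (hc : ∀ s, |env.optValue H m (h + 1) s - env.optValue H (m + 1) (h + 1) s| ≤ c)
    (s : Fin S) (a : Fin A) :
    |env.optQ H m h s a - env.optQ H (m + 1) h s a| ≤ env.stepVariation H m h + c := by
  have e : env.optQ H m h s a - env.optQ H (m + 1) h s a =
      (env.r m h s a - env.r (m + 1) h s a) +
      ∑ s', (env.P m h s a s' - env.P (m + 1) h s a s') * env.optValue H m (h + 1) s' +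
      ∑ s', env.P (m + 1) h s a s' *
        (env.optValue H m (h + 1) s' - env.optValue H (m + 1) (h + 1) s') := by
    simp only [optQ, sub_mul, mul_sub, Finset.sum_sub_distrib]
    ring
  have h1 : |env.r m h s a - env.r (m + 1) h s a| ≤
      ⨆ p : Fin S × Fin A, |env.r m h p.1 p.2 - env.r (m + 1) h p.1 p.2| :=
    le_ciSup (f := fun p : Fin S × Fin A => |env.r m h p.1 p.2 - env.r (m + 1) h p.1 p.2|)
      (Set.finite_range _).bddAbove (s, a)
  have h2 : ∑ s', |env.P m h s a s' - env.P (m + 1) h s a s'| ≤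
      ⨆ p : Fin S × Fin A, ∑ s', |env.P m h p.1 p.2 s' - env.P (m + 1) h p.1 p.2 s'| :=
    le_ciSup (f := fun p : Fin S × Fin A =>
      ∑ s', |env.P m h p.1 p.2 s' - env.P (m + 1) h p.1 p.2 s'|)
      (Set.finite_range _).bddAbove (s, a)
  have h3 : |∑ s', (env.P m h s a s' - env.P (m + 1) h s a s') * env.optValue H m (h + 1) s'| ≤
      H * ∑ s', |env.P m h s a s' - env.P (m + 1) h s a s'| := by
    rw [Finset.mul_sum]
    refine (Finset.abs_sum_le_sum_abs _ _).trans (Finset.sum_le_sum fun x _ => ?_)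
    rw [abs_mul, mul_comm]
    refine mul_le_mul_of_nonneg_right ?_ (abs_nonneg _)
    rw [abs_of_nonneg (env.optValue_nonneg hh x)]
    have := env.optValue_le (m := m) (h := h + 1) hh x
    have h0 : (0 : ℝ) ≤ ((h + 1 : ℕ) : ℝ) := Nat.cast_nonneg _
    linarith
  have h4 : |∑ s', env.P (m + 1) h s a s' *
        (env.optValue H m (h + 1) s' - env.optValue H (m + 1) (h + 1) s')| ≤ c := by
    refine (Finset.abs_sum_le_sum_abs _ _).trans ?_
    rw [← env.sum_P_const (m + 1) h s a c]
    refine Finset.sum_le_sum fun x _ => ?_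
    rw [abs_mul, abs_of_nonneg (env.P_nonneg _ _ _ _ _)]
    exact mul_le_mul_of_nonneg_left (hc x) (env.P_nonneg _ _ _ _ _)
  have h5 := mul_le_mul_of_nonneg_left h2 (Nat.cast_nonneg (α := ℝ) H)
  rw [e, stepVariation]
  refine (abs_add_le _ _).trans ?_
  have := abs_add_le (env.r m h s a - env.r (m + 1) h s a)
    (∑ s', (env.P m h s a s' - env.P (m + 1) h s a s') * env.optValue H m (h + 1) s')
  linarith

theorem abs_optValue_sub_succ_le [NeZero A] {H m k : ℕ} (hk : k ≤ H) (s : Fin S) :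
    |env.optValue H m (H - k) s - env.optValue H (m + 1) (H - k) s| ≤
      ∑ h ∈ Finset.Ico (H - k) H, env.stepVariation H m h := by
  induction k generalizing s with
  | zero => simp [optValue_self]
  | succ k ih =>
    rw [env.optValue_eq (by omega), env.optValue_eq (by omega)]
    rw [Finset.sum_eq_sum_Ico_succ_bot (by omega), show H - (k + 1) + 1 = H - k by omega]
    have : Nonempty (Fin A) := ⟨0⟩
    refine abs_ciSup_sub_ciSup_le _ _ _ fun a => ?_
    refine env.abs_optQ_sub_succ_le_aux (by omega) ?_ s a
    rw [show H - (k + 1) + 1 = H - k by omega]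
    exact ih (by omega)

theorem abs_optQ_sub_succ_le [NeZero A] {H m h : ℕ} (hh : h < H) (s : Fin S) (a : Fin A) :
    |env.optQ H m h s a - env.optQ H (m + 1) h s a| ≤
      env.rewardStep H m + H * env.transStep H m := by
  have h1 : ∀ s, |env.optValue H m (h + 1) s - env.optValue H (m + 1) (h + 1) s| ≤
      ∑ k ∈ Finset.Ico (h + 1) H, env.stepVariation H m k := by
    intro s
    have := env.abs_optValue_sub_succ_le (m := m) (k := H - (h + 1)) (H := H) (by omega) s
    rwa [show H - (H - (h + 1)) = h + 1 by omega] at this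
  have h2 := env.abs_optQ_sub_succ_le_aux hh h1 s a
  rw [← Finset.sum_eq_sum_Ico_succ_bot hh] at h2
  refine h2.trans ?_
  -- The steps before `h` are added back so that the bound no longer depends on `h`.
  have h3 : ∑ k ∈ Finset.Ico h H, env.stepVariation H m k ≤
      ∑ k ∈ Finset.range H, env.stepVariation H m k := by
    rw [Finset.range_eq_Ico]
    exact Finset.sum_le_sum_of_subset_of_nonneg (Finset.Ico_subset_Ico_left (Nat.zero_le _))
      fun k _ _ => env.stepVariation_nonneg H m k
  refine h3.trans (le_of_eq ?_)
  simp only [stepVariation, rewardStep, transStep, Finset.sum_add_distrib, Finset.mul_sum]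

theorem bonusDelta_eq (H M K d : ℕ) : env.bonusDelta H M K d =
    ∑ m ∈ Finset.Ico (d * K) (min ((d + 1) * K) M - 1),
      (env.rewardStep H m + H * env.transStep H m) := by
  simp only [bonusDelta, localReward, localTrans, Finset.sum_add_distrib, Finset.mul_sum]

theorem bonusDelta_nonneg (H M K d : ℕ) : 0 ≤ env.bonusDelta H M K d := by
  rw [bonusDelta_eq]
  exact Finset.sum_nonneg fun m _ => add_nonneg (env.rewardStep_nonneg H m)
    (mul_nonneg (Nat.cast_nonneg _) (env.transStep_nonneg H m))

theorem abs_optQ_sub_le_of_le [NeZero A] {H M K d h m m' : ℕ} (hh : h < H)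
    (hm : d * K ≤ m) (hmm : m ≤ m') (hm' : m' < min ((d + 1) * K) M) (s : Fin S) (a : Fin A) :
    |env.optQ H m h s a - env.optQ H m' h s a| ≤ env.bonusDelta H M K d := by
  have h1 : |env.optQ H m h s a - env.optQ H m' h s a| ≤
      ∑ k ∈ Finset.Ico m m', (env.rewardStep H k + H * env.transStep H k) := by
    clear hm'
    induction m', hmm using Nat.le_induction with
    | base => simp
    | succ n hn ih =>
      rw [Finset.sum_Ico_succ_top hn]
      have := env.abs_optQ_sub_succ_le (m := n) hh s a
      have h2 := abs_sub_le (env.optQ H m h s a) (env.optQ H n h s a) (env.optQ H (n + 1) h s a)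
      linarith
  rw [bonusDelta_eq]
  refine h1.trans (Finset.sum_le_sum_of_subset_of_nonneg
    (Finset.Ico_subset_Ico hm (by omega)) fun k _ _ => ?_)
  exact add_nonneg (env.rewardStep_nonneg H k)
    (mul_nonneg (Nat.cast_nonneg _) (env.transStep_nonneg H k))

theorem abs_optQ_sub_le [NeZero A] {H M K h m m' : ℕ} (hK : 0 < K) (hh : h < H)
    (hm : m < M) (hm' : m' < M) (hd : m / K = m' / K) (s : Fin S) (a : Fin A) :
    |env.optQ H m h s a - env.optQ H m' h s a| ≤ env.bonusDelta H M K (m / K) := by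
  have key : ∀ n, n / K = m / K → m / K * K ≤ n ∧ n < (m / K + 1) * K := fun n hn =>
    ⟨hn ▸ Nat.div_mul_le_self n K, (Nat.div_lt_iff_lt_mul hK).1 (by omega)⟩
  have k1 := key m rfl
  have k2 := key m' hd.symm
  rcases le_total m m' with h1 | h1
  · exact env.abs_optQ_sub_le_of_le hh k1.1 h1 (lt_min k2.2 hm') s a
  · rw [abs_sub_comm]
    exact env.abs_optQ_sub_le_of_le hh k2.1 h1 (lt_min k1.2 hm) s a

end NonstationaryMDP

/-! ### Exponential moments under independence -/

open ProbabilityTheory in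
/-- If `σ` takes finitely many values and is known at `F`, then multiplying by a factor whose
conditional mean given each value of `σ` is at most `1` does not increase the integral. -/
theorem lintegral_mul_le_of_indep {Ω τ : Type*} [Finite τ] {F mΩ : MeasurableSpace Ω}
    {μ : Measure Ω} (hF : F ≤ mΩ) {σ : Ω → τ} (hσ : ∀ x, MeasurableSet[F] (σ ⁻¹' {x}))
    {φ : τ → Ω → ENNReal} {F' : τ → MeasurableSpace Ω} (hF' : ∀ x, F' x ≤ mΩ)
    (hind : ∀ x, Indep F (F' x) μ) (hφ : ∀ x, Measurable[F' x] (φ x))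
    (hle : ∀ x, ∫⁻ ω, φ x ω ∂μ ≤ 1) {G : Ω → ENNReal} (hG : Measurable[F] G) :
    ∫⁻ ω, G ω * φ (σ ω) ω ∂μ ≤ ∫⁻ ω, G ω ∂μ := by
  classical
  have := Fintype.ofFinite τ
  have hm : ∀ x, Measurable[F] ((σ ⁻¹' {x}).indicator G) := fun x => hG.indicator (hσ x)
  -- On each event `σ = x` the random factor is the fixed `φ x`, which is independent of the part of
  -- `G` carried by that event.
  have e1 : ∀ ω, G ω * φ (σ ω) ω = ∑ x, (σ ⁻¹' {x}).indicator G ω * φ x ω := by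
    intro ω
    rw [Finset.sum_eq_single (σ ω)]
    · simp
    · intro x _ hx
      simp [hx.symm]
    · simp
  have e2 : ∀ ω, G ω = ∑ x, (σ ⁻¹' {x}).indicator G ω := by
    intro ω
    simp [Set.indicator_apply]
  simp_rw [e1]
  conv_rhs => simp only [e2]
  rw [lintegral_finsetSum' (f := fun x ω => (σ ⁻¹' {x}).indicator G ω * φ x ω) _
    fun x _ => (((hm x).mono hF le_rfl).mul
    ((hφ x).mono (hF' x) le_rfl)).aemeasurable, lintegral_finsetSum' _ fun x _ =>
    ((hm x).mono hF le_rfl).aemeasurable]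
  refine Finset.sum_le_sum fun x _ => ?_
  rw [lintegral_mul_eq_lintegral_mul_lintegral_of_independent_measurableSpace hF (hF' x) (hind x)
    (hm x) (hφ x)]
  exact mul_le_of_le_one_right' (hle x)

/-- An exponential supermartingale has mean at most `1`. -/
theorem lintegral_exp_sum_le_one {Ω : Type*} {mΩ : MeasurableSpace Ω} {μ : Measure Ω}
    [IsProbabilityMeasure μ] {F : ℕ → MeasurableSpace Ω} {Y : ℕ → Ω → ℝ}
    (hY : ∀ l n, l < n → Measurable[F n] (Y l))
    -- The conditional bound is tested against every nonnegative `F n`-measurable `G`; working in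
    -- `ENNReal` dispenses with integrability and conditional expectations.
    (hstep : ∀ n (G : Ω → ENNReal), Measurable[F n] G →
      ∫⁻ ω, G ω * ENNReal.ofReal (Real.exp (Y n ω)) ∂μ ≤ ∫⁻ ω, G ω ∂μ) (n : ℕ) :
    ∫⁻ ω, ENNReal.ofReal (Real.exp (∑ l ∈ Finset.range n, Y l ω)) ∂μ ≤ 1 := by
  induction n with
  | zero => simp
  | succ n ih =>
    refine le_trans (le_of_eq ?_) ((hstep n
      (fun ω => ENNReal.ofReal (Real.exp (∑ l ∈ Finset.range n, Y l ω))) ?_).trans ih)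
    · refine lintegral_congr fun ω => ?_
      rw [Finset.sum_range_succ, Real.exp_add, ENNReal.ofReal_mul (Real.exp_pos _).le]
    · refine ENNReal.measurable_ofReal.comp (Real.measurable_exp.comp ?_)
      exact Finset.measurable_fun_sum _ fun l hl => hY l n (Finset.mem_range.1 hl)

open ProbabilityTheory in
/-- Hoeffding's lemma. -/
theorem lintegral_exp_centered_le_one {E : Type*} [MeasurableSpace E] {ν : Measure E}
    [IsProbabilityMeasure ν] {f : E → ℝ} (hf : Measurable f) {a c : ℝ}
    (hb : ∀ᵐ x ∂ν, f x ∈ Set.Icc a (a + c)) (t : ℝ) :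
    ∫⁻ x, ENNReal.ofReal (Real.exp (t * (f x - ∫ y, f y ∂ν) - t ^ 2 * c ^ 2 / 8)) ∂ν ≤ 1 := by
  have h := hasSubgaussianMGF_of_mem_Icc hf.aemeasurable hb
  have h1 := h.mgf_le t
  have h2 := h.integrable_exp_mul t
  simp only [mgf] at h1
  have h3 : ((((‖a + c - a‖₊ / 2) ^ 2 : NNReal) : ℝ) * t ^ 2 / 2) = t ^ 2 * c ^ 2 / 8 := by
    simp only [add_sub_cancel_left, NNReal.coe_pow, NNReal.coe_div, coe_nnnorm, Real.norm_eq_abs,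
      NNReal.coe_ofNat, div_pow, sq_abs]
    ring
  rw [h3] at h1
  rw [← ofReal_integral_eq_lintegral_ofReal]
  · rw [ENNReal.ofReal_le_one]
    simp_rw [Real.exp_sub]
    rw [integral_div, div_le_one (Real.exp_pos _)]
    exact h1
  · simp_rw [Real.exp_sub]
    exact h2.div_const _
  · exact Filter.Eventually.of_forall fun x => (Real.exp_pos _).le

/-- Evaluation of a family of measurable functions at a random index. -/
theorem measurable_eval_of_countable {Ω τ E : Type*} [Countable τ] [MeasurableSpace τ]
    [MeasurableSingletonClass τ] [MeasurableSpace E] {mΩ : MeasurableSpace Ω} {σ : Ω → τ}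
    (hσ : Measurable σ) {f : τ → Ω → E} (hf : ∀ x, Measurable (f x)) :
    Measurable fun ω => f (σ ω) ω := by
  intro t ht
  have : (fun ω => f (σ ω) ω) ⁻¹' t = ⋃ x, σ ⁻¹' {x} ∩ f x ⁻¹' t := by
    ext ω; simp
  rw [this]
  exact MeasurableSet.iUnion fun x => (hσ (measurableSet_singleton x)).inter (hf x ht)

/-! ### Azuma–Hoeffding for the noise table -/

namespace NonstationaryMDP

variable {S A : ℕ} (env : NonstationaryMDP S A)

/-- Information available before step `h` of episode `m`. -/
abbrev past (S A m h : ℕ) : MeasurableSpace (ℕ × ℕ × Fin S × Fin A → ℝ × Fin S) :=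
  ⨆ i ∈ {i : ℕ × ℕ × Fin S × Fin A | i.1 < m ∨ i.1 = m ∧ i.2.1 < h},
    MeasurableSpace.comap (fun ω => ω i) inferInstance

theorem past_le (m h : ℕ) : past S A m h ≤ MeasurableSpace.pi :=
  iSup₂_le fun i _ => (measurable_pi_apply i).comap_le

theorem past_mono {m h m' h' : ℕ} (hm : m < m' ∨ m = m' ∧ h ≤ h') :
    past S A m h ≤ past S A m' h' := by
  refine biSup_mono fun i hi => ?_
  simp only [Set.mem_ofPred_eq] at hi ⊢
  omega

theorem measurable_past_apply {m h : ℕ} (i : ℕ × ℕ × Fin S × Fin A)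
    (hi : i.1 < m ∨ i.1 = m ∧ i.2.1 < h) :
    Measurable[past S A m h] fun ω : ℕ × ℕ × Fin S × Fin A → ℝ × Fin S => ω i := by
  rw [measurable_iff_comap_le]
  exact le_iSup₂_of_le i hi le_rfl

instance : IsProbabilityMeasure env.noise := by
  unfold noise; infer_instance

-- The entry at `(m, h, s, a)` is not among those generating `past S A m h`, and the entries of the
-- table are independent.
open ProbabilityTheory in
theorem indep_past (m h : ℕ) (s : Fin S) (a : Fin A) :
    Indep (past S A m h) (MeasurableSpace.comap (fun ω => ω (m, h, s, a)) inferInstance)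
      env.noise := by
  have h1 : iIndepFun (fun (i : ℕ × ℕ × Fin S × Fin A)
      (ω : ℕ × ℕ × Fin S × Fin A → ℝ × Fin S) => ω i) env.noise :=
    iIndepFun_infinitePi (X := fun _ x => x) fun _ => measurable_id
  have h2 := indep_iSup_of_disjoint (fun i => (measurable_pi_apply i).comap_le) h1
    (S := {i : ℕ × ℕ × Fin S × Fin A | i.1 < m ∨ i.1 = m ∧ i.2.1 < h}) (T := {(m, h, s, a)})
    (by simp)
  simpa [past] using h2

theorem map_noise (i : ℕ × ℕ × Fin S × Fin A) :
    env.noise.map (fun ω => ω i) =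
      (env.outcome i.1 i.2.1 i.2.2.1 i.2.2.2 : Measure (ℝ × Fin S)) :=
  Measure.infinitePi_map_eval _ i

/-- Azuma–Hoeffding inequality for the noise at step `h`, over the episodes in which
a condition known beforehand holds. -/
theorem noise_tail (h : ℕ) {τ : Type*} [Finite τ] [MeasurableSpace τ] [MeasurableSingletonClass τ]
    {σ : ℕ → (ℕ × ℕ × Fin S × Fin A → ℝ × Fin S) → τ}
    (hσ : ∀ n, Measurable[past S A n h] (σ n)) (act : ℕ → τ → Prop)
    [∀ n, DecidablePred (act n)] (loc : τ → Fin S × Fin A) {f : ℕ → τ → ℝ × Fin S → ℝ}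
    (hf : ∀ n x, Measurable (f n x)) {a c : ℝ} (hc : 0 < c)
    (hb : ∀ n x, act n x → ∀ᵐ y ∂(env.outcome n h (loc x).1 (loc x).2 : Measure (ℝ × Fin S)),
      f n x y ∈ Set.Icc a (a + c))
    (N k : ℕ) (hk : 0 < k) {ι : ℝ} (hι : 0 < ι) :
    env.noise {ω | c * √(k * ι) < ∑ n ∈ Finset.range N, (if act n (σ n ω) then
          f n (σ n ω) (ω (n, h, (loc (σ n ω)).1, (loc (σ n ω)).2)) -
            ∫ y, f n (σ n ω) y ∂(env.outcome n h (loc (σ n ω)).1 (loc (σ n ω)).2 :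
              Measure (ℝ × Fin S)) else 0) ∧
        (∑ n ∈ Finset.range N, if act n (σ n ω) then 1 else 0) ≤ k} ≤
      ENNReal.ofReal (Real.exp (-(2 * ι))) := by
  -- This `t` minimizes the Chernoff exponent `-t c √(k ι) + t² c² k / 8`, whose value becomes `-4 ι
  -- + 2 ι = -2 ι`.
  set t : ℝ := 4 * √(ι / k) / c with ht
  let mean : ℕ → τ → ℝ := fun n x =>
    ∫ y, f n x y ∂(env.outcome n h (loc x).1 (loc x).2 : Measure (ℝ × Fin S))
  -- The compensator is charged only in active episodes; with at most `k` of them it totals at most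
  -- `t² c² k / 8`, although the number of active episodes is random.
  let Z : ℕ → τ → ℝ × Fin S → ℝ := fun n x y =>
    if act n x then t * (f n x y - mean n x) - t ^ 2 * c ^ 2 / 8 else 0
  let Y : ℕ → (ℕ × ℕ × Fin S × Fin A → ℝ × Fin S) → ℝ := fun n ω =>
    Z n (σ n ω) (ω (n, h, (loc (σ n ω)).1, (loc (σ n ω)).2))
  have hZ : ∀ n x, Measurable (Z n x) := by
    intro n x
    by_cases hx : act n x
    · simp only [Z, hx, if_true]
      exact (((hf n x).sub_const _).const_mul _).sub_const _
    · simp only [Z, hx, if_false]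
      exact measurable_const
  have hYm : ∀ l n, l < n → Measurable[past S A n h] (Y l) := by
    intro l n hln
    refine measurable_eval_of_countable (mΩ := past S A n h)
      (f := fun x ω => Z l x (ω (l, h, (loc x).1, (loc x).2)))
      ((hσ l).mono (past_mono (Or.inl hln)) le_rfl) fun x => ?_
    exact (hZ l x).comp (measurable_past_apply _ (Or.inl hln))
  have hstep : ∀ n (G : (ℕ × ℕ × Fin S × Fin A → ℝ × Fin S) → ENNReal),
      Measurable[past S A n h] G →
      ∫⁻ ω, G ω * ENNReal.ofReal (Real.exp (Y n ω)) ∂env.noise ≤ ∫⁻ ω, G ω ∂env.noise := by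
    intro n G hG
    refine lintegral_mul_le_of_indep (past_le n h)
      (fun x => hσ n (measurableSet_singleton x))
      (φ := fun x ω => ENNReal.ofReal (Real.exp (Z n x (ω (n, h, (loc x).1, (loc x).2)))))
      (F' := fun x => MeasurableSpace.comap (fun ω => ω (n, h, (loc x).1, (loc x).2)) inferInstance)
      (fun x => (measurable_pi_apply _).comap_le) (fun x => env.indep_past n h _ _) (fun x => ?_)
      (fun x => ?_) hG
    · exact (ENNReal.measurable_ofReal.comp (Real.measurable_exp.comp (hZ n x))).comp
        (comap_measurable _)
    · have h1 := lintegral_map (μ := env.noise)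
        (ENNReal.measurable_ofReal.comp (Real.measurable_exp.comp (hZ n x)))
        (measurable_pi_apply (n, h, (loc x).1, (loc x).2))
      rw [map_noise] at h1
      simp only [Function.comp_apply] at h1
      rw [← h1]
      by_cases hx : act n x
      · simp only [Z, hx, if_true]
        exact lintegral_exp_centered_le_one (hf n x) (hb n x hx) t
      · simp [Z, hx]
  have h1 := lintegral_exp_sum_le_one hYm hstep N
  have h2 : Measurable fun ω => ENNReal.ofReal (Real.exp (∑ l ∈ Finset.range N, Y l ω)) := by
    refine ENNReal.measurable_ofReal.comp (Real.measurable_exp.comp ?_)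
    exact Finset.measurable_fun_sum _ fun l hl =>
      (hYm l (l + 1) (Nat.lt_succ_self l)).mono (past_le _ _) le_rfl
  have h3 := (mul_meas_ge_le_lintegral h2 (ENNReal.ofReal (Real.exp (2 * ι)))).trans h1
  have hk' : (0 : ℝ) < k := by exact_mod_cast hk
  have ht0 : 0 ≤ t := by positivity
  have e1 : t * (c * √(k * ι)) = 4 * ι := by
    have : √(ι / k) * √(k * ι) = ι := by
      rw [← Real.sqrt_mul (by positivity), show ι / k * (k * ι) = ι ^ 2 by field_simp,
        Real.sqrt_sq hι.le]
    calc t * (c * √(k * ι)) = 4 * (√(ι / k) * √(k * ι)) := by rw [ht]; field_simp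
      _ = 4 * ι := by rw [this]
  have e2 : t ^ 2 * c ^ 2 / 8 * k = 2 * ι := by
    rw [ht, div_pow, mul_pow, Real.sq_sqrt (by positivity)]
    field_simp
    norm_num
  calc _ ≤ env.noise {ω | ENNReal.ofReal (Real.exp (2 * ι)) ≤
        ENNReal.ofReal (Real.exp (∑ l ∈ Finset.range N, Y l ω))} := by
        refine measure_mono fun ω hω => ?_
        obtain ⟨w1, w2⟩ := hω
        refine ENNReal.ofReal_le_ofReal (Real.exp_le_exp.2 ?_)
        have e3 : ∑ l ∈ Finset.range N, Y l ω =
            t * (∑ n ∈ Finset.range N, (if act n (σ n ω) then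
              f n (σ n ω) (ω (n, h, (loc (σ n ω)).1, (loc (σ n ω)).2)) - mean n (σ n ω) else 0)) -
            t ^ 2 * c ^ 2 / 8 *
              ((∑ n ∈ Finset.range N, if act n (σ n ω) then 1 else 0 : ℕ) : ℝ) := by
          push_cast
          rw [Finset.mul_sum, Finset.mul_sum, ← Finset.sum_sub_distrib]
          refine Finset.sum_congr rfl fun n _ => ?_
          simp only [Y, Z]
          split_ifs <;> ring
        rw [e3]
        have w3 := mul_le_mul_of_nonneg_left w1.le ht0
        have w4 : t ^ 2 * c ^ 2 / 8 *
            ((∑ n ∈ Finset.range N, if act n (σ n ω) then 1 else 0 : ℕ) : ℝ) ≤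
            t ^ 2 * c ^ 2 / 8 * k :=
          mul_le_mul_of_nonneg_left (by exact_mod_cast w2) (by positivity)
        rw [e1] at w3
        rw [e2] at w4
        change 4 * ι ≤ t * (∑ n ∈ Finset.range N, (if act n (σ n ω) then
              f n (σ n ω) (ω (n, h, (loc (σ n ω)).1, (loc (σ n ω)).2)) - mean n (σ n ω) else 0))
          at w3
        linarith
    _ ≤ _ := by
        rw [Real.exp_neg, ENNReal.ofReal_inv_of_pos (Real.exp_pos _)]
        rw [mul_comm] at h3
        exact ENNReal.le_inv_iff_mul_le.2 h3

end NonstationaryMDP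

/-! ### Locality of the memory updates -/

namespace Memory

variable {S A : ℕ}

/-- The two memories hold the same variables at step `k`. -/
structure AgreeAt (k : ℕ) (x y : Memory S A) : Prop where
  Q : x.Q k = y.Q k
  V : x.V k = y.V k
  N : x.N k = y.N k
  cN : x.cN k = y.cN k
  cr : x.cr k = y.cr k
  cv : x.cv k = y.cv k

theorem AgreeAt.refl (k : ℕ) (x : Memory S A) : AgreeAt k x x := ⟨rfl, rfl, rfl, rfl, rfl, rfl⟩

theorem AgreeAt.trans {k : ℕ} {x y z : Memory S A} (h1 : AgreeAt k x y) (h2 : AgreeAt k y z) :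
    AgreeAt k x z :=
  ⟨h1.Q.trans h2.Q, h1.V.trans h2.V, h1.N.trans h2.N, h1.cN.trans h2.cN, h1.cr.trans h2.cr,
    h1.cv.trans h2.cv⟩

theorem agreeAt_step {k h : ℕ} (hk : k ≠ h) (H : ℕ) (ι bΔ : ℝ) (s : Fin S) (a : Fin A) (R : ℝ)
    (s' : Fin S) (mem : Memory S A) : AgreeAt k (mem.step H ι bΔ h s a R s') mem := by
  unfold step
  dsimp only
  constructor <;> split_ifs <;> ext <;> simp [setAt, hk]

end Memory

/-! ### Runs of the algorithm and one-episode recursions -/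

/-- The data of a run of RestartQ-UCB. -/
structure Run (S A : ℕ) where
  env : NonstationaryMDP S A
  g : GreedyRule S A
  H : ℕ
  M : ℕ
  δ' : ℝ
  s₁ : ℕ → Fin S

namespace Run

variable {S A : ℕ} (R : Run S A)

/-- The number of episodes in an epoch. -/
def K : ℕ := R.env.epochLength R.H R.M

/-- The logarithmic factor `ι`. -/
def ι : ℝ := Real.log (2 / R.δ')

/-- The extra bonus of epoch `d`. -/
def bonus (d : ℕ) : ℝ := R.env.bonusDelta R.H R.M R.K d

/-- Memory at the beginning of episode `m`. -/
def mem (ω : ℕ × ℕ × Fin S × Fin A → ℝ × Fin S) (m : ℕ) : Memory S A :=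
  RestartQUCB.memAt R.env R.g R.H R.M R.δ' R.s₁ ω m

/-- Memory and state after `h` steps of episode `m`. -/
def traj (ω : ℕ × ℕ × Fin S × Fin A → ℝ × Fin S) (m h : ℕ) : Memory S A × Fin S :=
  RestartQUCB.play R.g R.H R.ι (R.bonus (m / R.K)) ω m (R.mem ω m) (R.s₁ m) h

/-- The state at step `h` of episode `m`. -/
def st (ω : ℕ × ℕ × Fin S × Fin A → ℝ × Fin S) (m h : ℕ) : Fin S := (R.traj ω m h).2

/-- The action at step `h` of episode `m`. -/
def ac (ω : ℕ × ℕ × Fin S × Fin A → ℝ × Fin S) (m h : ℕ) : Fin A :=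
  R.g.pick m h (R.st ω m h) ((R.traj ω m h).1.Q h (R.st ω m h))

/-- The reward at step `h` of episode `m`. -/
def rew (ω : ℕ × ℕ × Fin S × Fin A → ℝ × Fin S) (m h : ℕ) : ℝ :=
  (ω (m, h, R.st ω m h, R.ac ω m h)).1

variable (ω : ℕ × ℕ × Fin S × Fin A → ℝ × Fin S)

theorem st_succ (m h : ℕ) : R.st ω m (h + 1) = (ω (m, h, R.st ω m h, R.ac ω m h)).2 := rfl

theorem traj_succ (m h : ℕ) : (R.traj ω m (h + 1)).1 =
    (R.traj ω m h).1.step R.H R.ι (R.bonus (m / R.K)) h (R.st ω m h) (R.ac ω m h) (R.rew ω m h)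
      (R.st ω m (h + 1)) := rfl

/-- Playing step `h` only writes variables of index `h`. So the action at step `h`, and the value `V
(h + 1)` in its sample, are those held at the beginning of the episode. -/
theorem agreeAt_traj_of_le {m h k : ℕ} (hk : h ≤ k) :
    Memory.AgreeAt k (R.traj ω m h).1 (R.mem ω m) := by
  induction h with
  | zero => exact Memory.AgreeAt.refl _ _
  | succ h ih =>
    rw [traj_succ]
    exact (Memory.agreeAt_step (by omega) _ _ _ _ _ _ _ _).trans (ih (by omega))

theorem agreeAt_traj_of_lt {m h k : ℕ} (hk : k < h) :
    Memory.AgreeAt k (R.traj ω m h).1 (R.traj ω m (k + 1)).1 := by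
  induction h, hk using Nat.le_induction with
  | base => exact Memory.AgreeAt.refl _ _
  | succ h hh ih =>
    rw [traj_succ]
    exact (Memory.agreeAt_step (by omega) _ _ _ _ _ _ _ _).trans ih

theorem mem_of_dvd {m : ℕ} (hm : R.K ∣ m) : R.mem ω m = Memory.init S A R.H := by
  cases m with
  | zero => rfl
  | succ m =>
    change (if R.K ∣ m + 1 then Memory.init S A R.H else (R.traj ω m R.H).1) = _
    rw [if_pos hm]

theorem mem_succ {m : ℕ} (hm : ¬ R.K ∣ m + 1) : R.mem ω (m + 1) = (R.traj ω m R.H).1 := by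
  change (if R.K ∣ m + 1 then Memory.init S A R.H else (R.traj ω m R.H).1) = _
  rw [if_neg hm]

theorem agreeAt_mem_succ {m h : ℕ} (hm : ¬ R.K ∣ m + 1) (hh : h < R.H) :
    Memory.AgreeAt h (R.mem ω (m + 1)) ((R.traj ω m h).1.step R.H R.ι (R.bonus (m / R.K)) h
      (R.st ω m h) (R.ac ω m h) (R.rew ω m h) (R.st ω m (h + 1))) := by
  rw [mem_succ _ _ hm]
  exact R.agreeAt_traj_of_lt ω hh

theorem V_last (m : ℕ) : (R.mem ω m).V R.H = fun _ => 0 := by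
  induction m with
  | zero => ext; simp [mem, RestartQUCB.memAt, Memory.init]
  | succ m ih =>
    by_cases hm : R.K ∣ m + 1
    · rw [mem_of_dvd _ _ hm]; ext; simp [Memory.init]
    · rw [mem_succ _ _ hm, (R.agreeAt_traj_of_le ω le_rfl).V, ih]

theorem ac_eq (m h : ℕ) :
    R.ac ω m h = R.g.pick m h (R.st ω m h) ((R.mem ω m).Q h (R.st ω m h)) := by
  rw [ac, (R.agreeAt_traj_of_le ω le_rfl).Q]

theorem mem_succ_of_not_visit {m h : ℕ} (hm : ¬ R.K ∣ m + 1) (hh : h < R.H) {s : Fin S}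
    {a : Fin A} (hv : ¬ (R.st ω m h = s ∧ R.ac ω m h = a)) :
    (R.mem ω (m + 1)).Q h s a = (R.mem ω m).Q h s a ∧
    (R.mem ω (m + 1)).N h s a = (R.mem ω m).N h s a ∧
    (R.mem ω (m + 1)).cN h s a = (R.mem ω m).cN h s a ∧
    (R.mem ω (m + 1)).cr h s a + (R.mem ω (m + 1)).cv h s a =
      (R.mem ω m).cr h s a + (R.mem ω m).cv h s a := by
  have h1 := R.agreeAt_mem_succ ω hm hh
  have h2 := R.agreeAt_traj_of_le ω (m := m) (h := h) (k := h) le_rfl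
  have hv' : ¬ (s = R.st ω m h ∧ a = R.ac ω m h) := fun h => hv ⟨h.1.symm, h.2.symm⟩
  rw [h1.Q, h1.N, h1.cN, h1.cr, h1.cv, ← h2.Q, ← h2.N, ← h2.cN, ← h2.cr, ← h2.cv]
  unfold Memory.step
  dsimp only
  refine ⟨?_, ?_, ?_, ?_⟩ <;> split_ifs <;> simp [setAt, hv']

theorem mem_succ_of_stageEnd {m h : ℕ} (hm : ¬ R.K ∣ m + 1) (hh : h < R.H) {s : Fin S}
    {a : Fin A} (hs : R.st ω m h = s) (ha : R.ac ω m h = a)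
    (hn : (R.mem ω m).N h s a + 1 ∈ stageEnds R.H) {cn : ℕ} (hcn : cn = (R.mem ω m).cN h s a + 1) :
    (R.mem ω (m + 1)).Q h s a = min
      (((R.mem ω m).cr h s a + (R.mem ω m).cv h s a +
        (R.rew ω m h + (R.mem ω m).V (h + 1) (R.st ω m (h + 1)))) / cn +
        (√((R.H : ℝ) ^ 2 / cn * R.ι) + √(1 / cn * R.ι)) + 2 * R.bonus (m / R.K))
      ((R.mem ω m).Q h s a) ∧
    (R.mem ω (m + 1)).N h s a = (R.mem ω m).N h s a + 1 ∧
    (R.mem ω (m + 1)).cN h s a = 0 ∧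
    (R.mem ω (m + 1)).cr h s a + (R.mem ω (m + 1)).cv h s a = 0 := by
  have h1 := R.agreeAt_mem_succ ω hm hh
  have h2 := R.agreeAt_traj_of_le ω (m := m) (h := h) (k := h) le_rfl
  have h3 := R.agreeAt_traj_of_le ω (m := m) (h := h) (k := h + 1) (Nat.le_succ h)
  rw [h1.Q, h1.N, h1.cN, h1.cr, h1.cv]
  unfold Memory.step
  rw [hs, ha, h2.N, if_pos hn, h2.Q, h2.cN, h2.cr, h2.cv, h3.V, ← hcn]
  refine ⟨?_, ?_, ?_, ?_⟩
  · simp only [setAt, and_self, if_true]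
    congr 3
    push_cast [hcn]
    rw [← add_div]
    congr 1
    ring
  all_goals simp [setAt]

theorem mem_succ_of_not_stageEnd {m h : ℕ} (hm : ¬ R.K ∣ m + 1) (hh : h < R.H) {s : Fin S}
    {a : Fin A} (hs : R.st ω m h = s) (ha : R.ac ω m h = a)
    (hn : (R.mem ω m).N h s a + 1 ∉ stageEnds R.H) :
    (R.mem ω (m + 1)).Q h s a = (R.mem ω m).Q h s a ∧
    (R.mem ω (m + 1)).N h s a = (R.mem ω m).N h s a + 1 ∧
    (R.mem ω (m + 1)).cN h s a = (R.mem ω m).cN h s a + 1 ∧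
    (R.mem ω (m + 1)).cr h s a + (R.mem ω (m + 1)).cv h s a =
      (R.mem ω m).cr h s a + (R.mem ω m).cv h s a +
        (R.rew ω m h + (R.mem ω m).V (h + 1) (R.st ω m (h + 1))) := by
  have h1 := R.agreeAt_mem_succ ω hm hh
  have h2 := R.agreeAt_traj_of_le ω (m := m) (h := h) (k := h) le_rfl
  have h3 := R.agreeAt_traj_of_le ω (m := m) (h := h) (k := h + 1) (Nat.le_succ h)
  rw [h1.Q, h1.N, h1.cN, h1.cr, h1.cv]
  unfold Memory.step
  rw [hs, ha, h2.N, if_neg hn]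
  simp only [setAt, h2.Q, h2.cN, h2.cr, h2.cv, h3.V]
  refine ⟨trivial, by simp, by simp, ?_⟩
  simp only [and_self, if_true]
  ring

/-- An update alters `Q` at one pair and recomputes `V` in that state, so the identity, true at
initialization, persists. -/
theorem V_eq [NeZero A] {m h : ℕ} (hh : h < R.H) (s : Fin S) :
    (R.mem ω m).V h s = ⨆ a, (R.mem ω m).Q h s a := by
  have : Nonempty (Fin A) := ⟨0⟩
  induction m with
  | zero => simp [mem, RestartQUCB.memAt, Memory.init]
  | succ m ih =>
    by_cases hm : R.K ∣ m + 1
    · rw [mem_of_dvd _ _ hm]; simp [Memory.init]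
    · have h1 := R.agreeAt_mem_succ ω hm hh
      have h2 := R.agreeAt_traj_of_le ω (m := m) (h := h) (k := h) le_rfl
      rw [h1.Q, h1.V]
      unfold Memory.step
      dsimp only
      split_ifs
      · simp only [true_and]
        split_ifs with h3
        · rw [h3]
        · simp only [setAt, h3, false_and, and_false, if_false, h2.V, h2.Q, ih]
      · simp only [h2.V, h2.Q, ih]

/-! ### Stages along the path -/

/-- Episode `l` of epoch `d` visits `(s, a)` at step `h`. -/
def Visit (h : ℕ) (s : Fin S) (a : Fin A) (d l : ℕ) : Prop :=
  l / R.K = d ∧ R.st ω l h = s ∧ R.ac ω l h = a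

instance (h : ℕ) (s : Fin S) (a : Fin A) (d : ℕ) : DecidablePred (R.Visit ω h s a d) :=
  fun _ => inferInstanceAs (Decidable (_ ∧ _ ∧ _))

/-- The number of visits in epoch `d` before episode `l`. -/
def cnt (h : ℕ) (s : Fin S) (a : Fin A) (d l : ℕ) : ℕ := Nat.count (R.Visit ω h s a d) l

/-- The sum of `x` over the visits of stage `j` of epoch `d` before episode `m`. -/
def stageTotal (h : ℕ) (s : Fin S) (a : Fin A) (d j m : ℕ) {E : Type} [AddCommMonoid E]
    (x : ℕ → E) : E :=
  ∑ l ∈ Finset.range m, if R.Visit ω h s a d l then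
    if stageIndex R.H (R.cnt ω h s a d l) = j then x l else 0 else 0

/-- The sample used by the updates at a visit. -/
def sample (h l : ℕ) : ℝ := R.rew ω l h + (R.mem ω l).V (h + 1) (R.st ω l (h + 1))

/-- The value estimate obtained from stage `j` of epoch `d`. -/
def estimate (h : ℕ) (s : Fin S) (a : Fin A) (d j m : ℕ) : ℝ :=
  R.stageTotal ω h s a d j m (R.sample ω h) / stageLength R.H j +
    (√((R.H : ℝ) ^ 2 / stageLength R.H j * R.ι) + √(1 / stageLength R.H j * R.ι)) +
    2 * R.bonus d

theorem cnt_succ (h : ℕ) (s : Fin S) (a : Fin A) (d l : ℕ) :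
    R.cnt ω h s a d (l + 1) = R.cnt ω h s a d l + if R.Visit ω h s a d l then 1 else 0 :=
  Nat.count_succ _ _

theorem stageTotal_succ (h : ℕ) (s : Fin S) (a : Fin A) (d j m : ℕ) {E : Type} [AddCommMonoid E]
    (x : ℕ → E) : R.stageTotal ω h s a d j (m + 1) x = R.stageTotal ω h s a d j m x +
      if R.Visit ω h s a d m then
        if stageIndex R.H (R.cnt ω h s a d m) = j then x m else 0 else 0 :=
  Finset.sum_range_succ _ _

theorem stageTotal_one (h : ℕ) (s : Fin S) (a : Fin A) (d j m : ℕ) :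
    R.stageTotal ω h s a d j m (fun _ => (1 : ℕ)) =
      ∑ k ∈ Finset.range (R.cnt ω h s a d m), if stageIndex R.H k = j then 1 else 0 :=
  sum_rank (R.Visit ω h s a d) (fun k => if stageIndex R.H k = j then 1 else 0) m

theorem stageTotal_eq_zero (h : ℕ) (s : Fin S) (a : Fin A) {d j m : ℕ} {E : Type}
    [AddCommMonoid E] (x : ℕ → E) (hj : stageIndex R.H (R.cnt ω h s a d m) < j) :
    R.stageTotal ω h s a d j (m + 1) x = 0 := by
  refine Finset.sum_eq_zero fun l hl => ?_
  have h1 := stageIndex_mono R.H (Nat.count_monotone (R.Visit ω h s a d)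
    (Nat.lt_succ_iff.1 (Finset.mem_range.1 hl)))
  change stageIndex R.H (R.cnt ω h s a d l) ≤ stageIndex R.H (R.cnt ω h s a d m) at h1
  split_ifs <;> first | rfl | omega

theorem not_visit_of_dvd {h : ℕ} {s : Fin S} {a : Fin A} {m l : ℕ} (hK : 0 < R.K)
    (hm : R.K ∣ m) (hl : l < m) : ¬ R.Visit ω h s a (m / R.K) l := by
  rintro ⟨h1, -⟩
  have h2 := (Nat.div_lt_iff_lt_mul hK).2 (show l < m / R.K * R.K by rwa [Nat.div_mul_cancel hm])
  omega

theorem cnt_of_dvd (h : ℕ) (s : Fin S) (a : Fin A) {m : ℕ} (hK : 0 < R.K) (hm : R.K ∣ m) :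
    R.cnt ω h s a (m / R.K) m = 0 := by
  rw [cnt, Nat.count_eq_card_filter_range, Finset.card_eq_zero, Finset.filter_eq_empty_iff]
  exact fun l hl => R.not_visit_of_dvd ω hK hm (Finset.mem_range.1 hl)

theorem stageTotal_of_dvd (h : ℕ) (s : Fin S) (a : Fin A) {j m : ℕ} {E : Type} [AddCommMonoid E]
    (x : ℕ → E) (hK : 0 < R.K) (hm : R.K ∣ m) :
    R.stageTotal ω h s a (m / R.K) j m x = 0 :=
  Finset.sum_eq_zero fun l hl => by
    rw [if_neg (R.not_visit_of_dvd ω hK hm (Finset.mem_range.1 hl))]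

/-- The contents of the memory at `(h, s, a)` in terms of the past visits. -/
structure Invariant (h : ℕ) (s : Fin S) (a : Fin A) (m : ℕ) : Prop where
  N_eq : (R.mem ω m).N h s a = R.cnt ω h s a (m / R.K) m
  cN_eq : (R.mem ω m).cN h s a = R.stageTotal ω h s a (m / R.K)
    (stageIndex R.H (R.cnt ω h s a (m / R.K) m)) m fun _ => 1
  -- Updates of `Q` see the two accumulators only through their sum, so only the sum is tracked.
  c_eq : (R.mem ω m).cr h s a + (R.mem ω m).cv h s a = R.stageTotal ω h s a (m / R.K)
    (stageIndex R.H (R.cnt ω h s a (m / R.K) m)) m (R.sample ω h)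
  -- The last three fields characterize `Q` as the minimum of its initial value and the estimates of
  -- the finished stages: upper bounds serve the regret, `le_Q` serves optimism.
  Q_le : (R.mem ω m).Q h s a ≤ (R.H : ℝ) - h
  Q_le_estimate : ∀ j < stageIndex R.H (R.cnt ω h s a (m / R.K) m),
    (R.mem ω m).Q h s a ≤ R.estimate ω h s a (m / R.K) j m
  le_Q : ∀ x ≤ (R.H : ℝ) - h, (∀ j < stageIndex R.H (R.cnt ω h s a (m / R.K) m),
    x ≤ R.estimate ω h s a (m / R.K) j m) → x ≤ (R.mem ω m).Q h s a

theorem invariant_of_dvd (h : ℕ) (s : Fin S) (a : Fin A) {m : ℕ} (hH : 0 < R.H) (hK : 0 < R.K)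
    (hm : R.K ∣ m) : R.Invariant ω h s a m := by
  have h0 := R.cnt_of_dvd ω h s a hK hm
  have h1 := stageIndex_zero R.H hH
  constructor
  · rw [mem_of_dvd _ _ hm, h0]; rfl
  · rw [mem_of_dvd _ _ hm, stageTotal_of_dvd _ _ _ _ _ _ hK hm]; rfl
  · rw [mem_of_dvd _ _ hm, stageTotal_of_dvd _ _ _ _ _ _ hK hm]; simp [Memory.init]
  · rw [mem_of_dvd _ _ hm]; exact le_rfl
  · rw [h0, h1]; intro j hj; omega
  · intro x hx _; rw [mem_of_dvd _ _ hm]; exact hx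

theorem estimate_succ (h : ℕ) (s : Fin S) (a : Fin A) {d j m : ℕ}
    (hj : j < stageIndex R.H (R.cnt ω h s a d m)) :
    R.estimate ω h s a d j (m + 1) = R.estimate ω h s a d j m := by
  rw [estimate, estimate, stageTotal_succ, if_neg (c := stageIndex _ _ = _) (by omega), ite_self,
    add_zero]

theorem invariant (hH : 0 < R.H) (hK : 0 < R.K) {h : ℕ} (hh : h < R.H) (s : Fin S) (a : Fin A)
    (m : ℕ) : R.Invariant ω h s a m := by
  induction m with
  | zero => exact R.invariant_of_dvd ω h s a hH hK (dvd_zero _)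
  | succ m ih =>
    by_cases hm : R.K ∣ m + 1
    · exact R.invariant_of_dvd ω h s a hH hK hm
    have hd : (m + 1) / R.K = m / R.K := Nat.succ_div_of_not_dvd hm
    set d := m / R.K with hdef
    by_cases hv : R.st ω m h = s ∧ R.ac ω m h = a
    · have hvis : R.Visit ω h s a d m := ⟨rfl, hv⟩
      have hcnt : R.cnt ω h s a d (m + 1) = R.cnt ω h s a d m + 1 := by
        rw [cnt_succ, if_pos hvis]
      have hN := ih.N_eq
      by_cases hn : (R.mem ω m).N h s a + 1 ∈ stageEnds R.H
      · have hst : stageIndex R.H (R.cnt ω h s a d (m + 1)) =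
            stageIndex R.H (R.cnt ω h s a d m) + 1 := by
          rw [hcnt, stageIndex_succ, if_pos (hN ▸ hn)]
        -- The current visit closes the stage, so the divisor `cN + 1` of the update is the full
        -- stage length appearing in `estimate`.
        have hcn : stageLength R.H (stageIndex R.H (R.cnt ω h s a d m)) =
            (R.mem ω m).cN h s a + 1 := by
          rw [ih.cN_eq, ← card_stage_eq R.H (R.cnt ω h s a d (m + 1)) _ hH
            (hst ▸ Nat.lt_succ_self _), ← stageTotal_one, stageTotal_succ, if_pos hvis, if_pos rfl]
        obtain ⟨q1, q2, q3, q4⟩ := R.mem_succ_of_stageEnd ω hm hh hv.1 hv.2 hn hcn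
        have hQ : (R.mem ω (m + 1)).Q h s a =
            min (R.estimate ω h s a d (stageIndex R.H (R.cnt ω h s a d m)) (m + 1))
              ((R.mem ω m).Q h s a) := by
          rw [q1, estimate, stageTotal_succ, if_pos hvis, if_pos rfl, ih.c_eq]; rfl
        constructor
        · rw [q2, hN, hd, hcnt]
        · rw [q3, hd, hst, stageTotal_eq_zero _ _ _ _ _ _ (Nat.lt_succ_self _)]
        · rw [q4, hd, hst, stageTotal_eq_zero _ _ _ _ _ _ (Nat.lt_succ_self _)]
        · rw [hQ]; exact (min_le_right _ _).trans ih.Q_le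
        · rw [hd, hst, hQ]
          intro j hj
          rcases Nat.lt_succ_iff_lt_or_eq.1 hj with hj | rfl
          · rw [estimate_succ _ _ _ _ _ hj]
            exact (min_le_right _ _).trans (ih.Q_le_estimate j hj)
          · exact min_le_left _ _
        · rw [hd, hst, hQ]
          intro x hx hj
          refine le_min (hj _ (Nat.lt_succ_self _)) (ih.le_Q x hx fun j hj' => ?_)
          rw [← estimate_succ _ _ _ _ _ hj']
          exact hj j (hj'.trans (Nat.lt_succ_self _))
      · have hst : stageIndex R.H (R.cnt ω h s a d (m + 1)) =
            stageIndex R.H (R.cnt ω h s a d m) := by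
          rw [hcnt, stageIndex_succ, if_neg (hN ▸ hn), add_zero]
        obtain ⟨q1, q2, q3, q4⟩ := R.mem_succ_of_not_stageEnd ω hm hh hv.1 hv.2 hn
        constructor
        · rw [q2, hN, hd, hcnt]
        · rw [q3, hd, hst, stageTotal_succ, if_pos hvis, if_pos rfl, ih.cN_eq]
        · rw [q4, hd, hst, stageTotal_succ, if_pos hvis, if_pos rfl, ih.c_eq]; rfl
        · rw [q1]; exact ih.Q_le
        · rw [hd, hst, q1]
          intro j hj
          rw [estimate_succ _ _ _ _ _ hj]
          exact ih.Q_le_estimate j hj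
        · rw [hd, hst, q1]
          intro x hx hj
          refine ih.le_Q x hx fun j hj' => ?_
          rw [← estimate_succ _ _ _ _ _ hj']
          exact hj j hj'
    · have hvis : ¬ R.Visit ω h s a d m := fun h => hv h.2
      have hcnt : R.cnt ω h s a d (m + 1) = R.cnt ω h s a d m := by
        rw [cnt_succ, if_neg hvis, add_zero]
      obtain ⟨q1, q2, q3, q4⟩ := R.mem_succ_of_not_visit ω hm hh hv
      constructor
      · rw [q2, ih.N_eq, hd, hcnt]
      · rw [q3, hd, hcnt, stageTotal_succ, if_neg hvis, ih.cN_eq, add_zero]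
      · rw [q4, hd, hcnt, stageTotal_succ, if_neg hvis, ih.c_eq, add_zero]
      · rw [q1]; exact ih.Q_le
      · rw [hd, hcnt, q1]
        intro j hj
        rw [estimate_succ _ _ _ _ _ hj]
        exact ih.Q_le_estimate j hj
      · rw [hd, hcnt, q1]
        intro x hx hj
        refine ih.le_Q x hx fun j hj' => ?_
        rw [← estimate_succ _ _ _ _ _ hj']
        exact hj j hj'

end Run

/-! ### Measurability of memories and trajectories -/

namespace Memory

variable {S A : ℕ}

/-- All variables of a random memory are measurable. -/
structure IsMeasurable {Ω : Type*} (mΩ : MeasurableSpace Ω) (x : Ω → Memory S A) : Prop where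
  Q : ∀ h s a, Measurable[mΩ] fun ω => (x ω).Q h s a
  V : ∀ h s, Measurable[mΩ] fun ω => (x ω).V h s
  N : ∀ h s a, Measurable[mΩ] fun ω => (x ω).N h s a
  cN : ∀ h s a, Measurable[mΩ] fun ω => (x ω).cN h s a
  cr : ∀ h s a, Measurable[mΩ] fun ω => (x ω).cr h s a
  cv : ∀ h s a, Measurable[mΩ] fun ω => (x ω).cv h s a

theorem IsMeasurable.mono {Ω : Type*} {m₁ m₂ : MeasurableSpace Ω} {x : Ω → Memory S A}
    (hx : IsMeasurable m₁ x) (h : m₁ ≤ m₂) : IsMeasurable m₂ x :=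
  ⟨fun k s a => (hx.Q k s a).mono h le_rfl, fun k s => (hx.V k s).mono h le_rfl,
    fun k s a => (hx.N k s a).mono h le_rfl, fun k s a => (hx.cN k s a).mono h le_rfl,
    fun k s a => (hx.cr k s a).mono h le_rfl, fun k s a => (hx.cv k s a).mono h le_rfl⟩

theorem isMeasurable_const {Ω : Type*} (mΩ : MeasurableSpace Ω) (x : Memory S A) :
    IsMeasurable mΩ fun _ : Ω => x := by
  constructor <;> intros <;> exact measurable_const

theorem IsMeasurable.eval {Ω τ : Type*} [Countable τ] [MeasurableSpace τ]
    [MeasurableSingletonClass τ] {mΩ : MeasurableSpace Ω} {σ : Ω → τ}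
    (hσ : Measurable σ) {x : τ → Ω → Memory S A} (hx : ∀ t, IsMeasurable mΩ (x t)) :
    IsMeasurable mΩ fun ω => x (σ ω) ω :=
  ⟨fun k s a => measurable_eval_of_countable hσ (f := fun t ω => (x t ω).Q k s a)
      fun t => (hx t).Q k s a,
    fun k s => measurable_eval_of_countable hσ (f := fun t ω => (x t ω).V k s)
      fun t => (hx t).V k s,
    fun k s a => measurable_eval_of_countable hσ (f := fun t ω => (x t ω).N k s a)
      fun t => (hx t).N k s a,
    fun k s a => measurable_eval_of_countable hσ (f := fun t ω => (x t ω).cN k s a)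
      fun t => (hx t).cN k s a,
    fun k s a => measurable_eval_of_countable hσ (f := fun t ω => (x t ω).cr k s a)
      fun t => (hx t).cr k s a,
    fun k s a => measurable_eval_of_countable hσ (f := fun t ω => (x t ω).cv k s a)
      fun t => (hx t).cv k s a⟩

theorem measurable_setAt {Ω : Type*} [MeasurableSpace Ω] {β : Type} [MeasurableSpace β]
    {f : Ω → ℕ → Fin S → Fin A → β} (hf : ∀ h s a, Measurable fun ω => f ω h s a) (h : ℕ)
    (s : Fin S) (a : Fin A) {y : Ω → β} (hy : Measurable y) (h' : ℕ) (s' : Fin S) (a' : Fin A) :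
    Measurable fun ω => setAt (f ω) h s a (y ω) h' s' a' := by
  unfold setAt
  split_ifs
  · exact hy
  · exact hf _ _ _

theorem IsMeasurable.step {Ω : Type*} {mΩ : MeasurableSpace Ω} {x : Ω → Memory S A}
    (hx : IsMeasurable mΩ x) (H : ℕ) (ι bΔ : ℝ) (h : ℕ) (s : Fin S) (a : Fin A) {R : Ω → ℝ}
    (hR : Measurable R) {s' : Ω → Fin S} (hs' : Measurable s') :
    IsMeasurable mΩ fun ω => (x ω).step H ι bΔ h s a (R ω) (s' ω) := by
  have hV : Measurable fun ω => (x ω).V (h + 1) (s' ω) :=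
    measurable_eval_of_countable hs' (f := fun t ω => (x ω).V (h + 1) t) fun t => hx.V _ t
  have hn : MeasurableSet {ω | (x ω).N h s a + 1 ∈ stageEnds H} :=
    (hx.N h s a) (MeasurableSet.of_discrete (s := {n | n + 1 ∈ stageEnds H}))
  have hcr := (hx.cr h s a).add hR
  have hcv := (hx.cv h s a).add hV
  have hcn : Measurable fun ω => (x ω).cN h s a + 1 := (hx.cN h s a).add_const 1
  have hcn' : Measurable fun ω => (((x ω).cN h s a + 1 : ℕ) : ℝ) :=
    (measurable_from_top (f := fun n : ℕ => (n : ℝ))).comp hcn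
  have hQ := measurable_setAt hx.Q h s a (y := fun ω =>
    min (((x ω).cr h s a + R ω) / (((x ω).cN h s a + 1 : ℕ) : ℝ) +
      ((x ω).cv h s a + (x ω).V (h + 1) (s' ω)) / (((x ω).cN h s a + 1 : ℕ) : ℝ) +
      (√((H : ℝ) ^ 2 / (((x ω).cN h s a + 1 : ℕ) : ℝ) * ι) +
        √(1 / (((x ω).cN h s a + 1 : ℕ) : ℝ) * ι)) + 2 * bΔ) ((x ω).Q h s a))
    (((((hcr.div hcn').add (hcv.div hcn')).add
      ((((measurable_const.div hcn').mul_const ι).sqrt).add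
        (((measurable_const.div hcn').mul_const ι).sqrt))).add_const _).min (hx.Q h s a))
  unfold Memory.step
  dsimp only
  constructor
  · intro k t b
    simp only [apply_ite Memory.Q, ite_apply]
    exact Measurable.ite hn (hQ k t b) (hx.Q k t b)
  · intro k t
    simp only [apply_ite Memory.V, ite_apply]
    refine Measurable.ite hn ?_ (hx.V k t)
    split_ifs
    · exact Measurable.iSup fun b => hQ h s b
    · exact hx.V k t
  · intro k t b
    simp only [apply_ite Memory.N, ite_self]
    exact measurable_setAt hx.N h s a ((hx.N h s a).add_const 1) k t b
  · intro k t b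
    simp only [apply_ite Memory.cN, ite_apply]
    exact Measurable.ite hn (measurable_setAt hx.cN h s a measurable_const k t b)
      (measurable_setAt hx.cN h s a hcn k t b)
  · intro k t b
    simp only [apply_ite Memory.cr, ite_apply]
    exact Measurable.ite hn (measurable_setAt hx.cr h s a measurable_const k t b)
      (measurable_setAt hx.cr h s a hcr k t b)
  · intro k t b
    simp only [apply_ite Memory.cv, ite_apply]
    exact Measurable.ite hn (measurable_setAt hx.cv h s a measurable_const k t b)
      (measurable_setAt hx.cv h s a hcv k t b)

end Memory

namespace Run

open NonstationaryMDP

variable {S A : ℕ} (R : Run S A)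

/-- The noise is read at a random table index, but that index takes finitely many values and is
known before the step; `measurable_eval_of_countable` then applies. -/
theorem measurable_traj {m : ℕ} (hm : Memory.IsMeasurable (past S A m 0) fun ω => R.mem ω m)
    (h : ℕ) :
    (Memory.IsMeasurable (past S A m h) fun ω => (R.traj ω m h).1) ∧
      Measurable[past S A m h] fun ω => R.st ω m h := by
  induction h with
  | zero => exact ⟨hm, measurable_const⟩
  | succ h ih =>
    have hle : past S A m h ≤ past S A m (h + 1) := past_mono (Or.inr ⟨rfl, Nat.le_succ h⟩)
    have hac : Measurable[past S A m h] fun ω => R.ac ω m h := by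
      refine @measurable_eval_of_countable _ (Fin S) _ _ _ _ _ (past S A m h) _ ih.2
        (fun s ω => R.g.pick m h s ((R.traj ω m h).1.Q h s)) fun s => ?_
      exact (R.g.measurable_pick m h s).comp
        (@measurable_pi_lambda _ _ _ (past S A m h) _ _ fun a => ih.1.Q h s a)
    have hσ : Measurable[past S A m (h + 1)] fun ω => (R.st ω m h, R.ac ω m h) :=
      (ih.2.prodMk hac).mono hle le_rfl
    have hω : Measurable[past S A m (h + 1)] fun ω => ω (m, h, R.st ω m h, R.ac ω m h) :=
      @measurable_eval_of_countable _ (Fin S × Fin A) _ _ _ _ _ (past S A m (h + 1)) _ hσ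
        (fun p ω => ω (m, h, p.1, p.2))
        fun p => measurable_past_apply _ (Or.inr ⟨rfl, Nat.lt_succ_self h⟩)
    have hst : Measurable[past S A m (h + 1)] fun ω => R.st ω m (h + 1) := by
      have := measurable_snd.comp hω
      exact this
    refine ⟨?_, hst⟩
    exact Memory.IsMeasurable.eval hσ
      (x := fun p ω => (R.traj ω m h).1.step R.H R.ι (R.bonus (m / R.K)) h p.1 p.2
        (R.rew ω m h) (R.st ω m (h + 1)))
      fun p => (ih.1.mono hle).step _ _ _ _ _ _ (measurable_fst.comp hω) hst

theorem measurable_mem (m : ℕ) :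
    Memory.IsMeasurable (past S A m 0) fun ω => R.mem ω m := by
  induction m with
  | zero => exact Memory.isMeasurable_const _ _
  | succ m ih =>
    by_cases hm : R.K ∣ m + 1
    · simp_rw [R.mem_of_dvd _ hm]
      exact Memory.isMeasurable_const _ _
    · simp_rw [R.mem_succ _ hm]
      exact (R.measurable_traj ih R.H).1.mono (past_mono (Or.inl (Nat.lt_succ_self m)))

theorem measurable_st (m h : ℕ) : Measurable[past S A m h] fun ω => R.st ω m h :=
  (R.measurable_traj (R.measurable_mem m) h).2

/-- The policy of episode `m`. -/
def pol (ω : ℕ × ℕ × Fin S × Fin A → ℝ × Fin S) (m : ℕ) : ℕ → Fin S → Fin A :=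
  RestartQUCB.policy R.env R.g R.H R.M R.δ' R.s₁ ω m

theorem ac_eq_pol (ω : ℕ × ℕ × Fin S × Fin A → ℝ × Fin S) (m h : ℕ) :
    R.ac ω m h = R.pol ω m h (R.st ω m h) := R.ac_eq ω m h

theorem measurable_pol (m k h : ℕ) (s : Fin S) :
    Measurable[past S A m k] fun ω => R.pol ω m h s := by
  have h1 : Measurable[past S A m 0] fun ω => R.pol ω m h s :=
    (R.g.measurable_pick m h s).comp
      (@measurable_pi_lambda _ _ _ (past S A m 0) _ _ fun a => (R.measurable_mem m).Q h s a)
  exact h1.mono (past_mono (Or.inr ⟨rfl, Nat.zero_le _⟩)) le_rfl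

theorem measurable_ac (m h : ℕ) : Measurable[past S A m h] fun ω => R.ac ω m h := by
  simp_rw [ac_eq_pol]
  exact @measurable_eval_of_countable _ (Fin S) _ _ _ _ _ (past S A m h) _ (R.measurable_st m h)
    (fun s ω => R.pol ω m h s) fun s => R.measurable_pol m h h s

/-! ### The good event -/

/-- Episode `m` of epoch `d` visits `(s, a)` at step `h` during stage `j`. -/
def StageVisit (h : ℕ) (s : Fin S) (a : Fin A) (d j m : ℕ)
    (ω : ℕ × ℕ × Fin S × Fin A → ℝ × Fin S) : Prop :=
  -- The stage is read off the stored counter rather than the visit history, which makes the event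
  -- visibly known before step `h`; `stageVisit_iff` links the two descriptions.
  m / R.K = d ∧ R.st ω m h = s ∧ R.ac ω m h = a ∧ stageIndex R.H ((R.mem ω m).N h s a) = j

instance (h : ℕ) (s : Fin S) (a : Fin A) (d j m : ℕ)
    (ω : ℕ × ℕ × Fin S × Fin A → ℝ × Fin S) : Decidable (R.StageVisit h s a d j m ω) :=
  inferInstanceAs (Decidable (_ ∧ _ ∧ _ ∧ _))

theorem measurable_stageVisit (h : ℕ) (s : Fin S) (a : Fin A) (d j m : ℕ) :
    Measurable[past S A m h] fun ω => decide (R.StageVisit h s a d j m ω) := by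
  have hle : past S A m 0 ≤ past S A m h := past_mono (Or.inr ⟨rfl, Nat.zero_le _⟩)
  have hN := ((R.measurable_mem m).N h s a).mono hle le_rfl
  have h1 : MeasurableSet[past S A m h] {ω | R.StageVisit h s a d j m ω} := by
    refine MeasurableSet.inter (m := past S A m h) ?_ (MeasurableSet.inter (m := past S A m h)
      (R.measurable_st m h (measurableSet_singleton s)) (MeasurableSet.inter (m := past S A m h)
      (R.measurable_ac m h (measurableSet_singleton a))
      (hN (MeasurableSet.of_discrete (s := {n | stageIndex R.H n = j})))))
    exact @MeasurableSet.const _ (past S A m h) (m / R.K = d)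
  refine @measurable_to_bool _ (past S A m h) _ ?_
  convert h1 using 1
  ext ω
  simp

/-- The deviation of the samples of a stage from their means, with the optimal values as targets. -/
def stageDeviation (h : ℕ) (s : Fin S) (a : Fin A) (d j : ℕ)
    (ω : ℕ × ℕ × Fin S × Fin A → ℝ × Fin S) : ℝ :=
  ∑ m ∈ Finset.range R.M, if R.StageVisit h s a d j m ω then
    R.rew ω m h + R.env.optValue R.H m (h + 1) (R.st ω m (h + 1)) - R.env.optQ R.H m h s a else 0

/-- The gap between the optimal value and the value of the policy of episode `m`. -/
def gap (ω : ℕ × ℕ × Fin S × Fin A → ℝ × Fin S) (m h : ℕ) (s : Fin S) : ℝ :=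
  R.env.optValue R.H m h s - R.env.value R.H m (R.pol ω m) h s

/-- The deviation of the gaps from their conditional means along the path. -/
def gapDeviation (h : ℕ) (ω : ℕ × ℕ × Fin S × Fin A → ℝ × Fin S) : ℝ :=
  ∑ m ∈ Finset.range R.M,
    (∑ s', R.env.P m h (R.st ω m h) (R.ac ω m h) s' * R.gap ω m (h + 1) s' -
      R.gap ω m (h + 1) (R.st ω m (h + 1)))

/-- The number of visits in a stage. -/
def stageCount (h : ℕ) (s : Fin S) (a : Fin A) (d j : ℕ)
    (ω : ℕ × ℕ × Fin S × Fin A → ℝ × Fin S) : ℕ :=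
  ∑ m ∈ Finset.range R.M, if R.StageVisit h s a d j m ω then 1 else 0

theorem measurable_target (m h : ℕ) :
    Measurable fun x : ℝ × Fin S => x.1 + R.env.optValue R.H m h x.2 :=
  measurable_fst.add ((measurable_of_countable (R.env.optValue R.H m h)).comp measurable_snd)

theorem target_mem [NeZero A] {m h : ℕ} (hh : h < R.H) (s : Fin S) (a : Fin A) :
    ∀ᵐ x ∂(R.env.outcome m h s a : Measure (ℝ × Fin S)),
      x.1 + R.env.optValue R.H m (h + 1) x.2 ∈ Set.Icc (0 : ℝ) (0 + ((R.H : ℝ) + 1)) := by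
  filter_upwards [R.env.reward_mem m h s a] with x hx
  have h1 := R.env.optValue_nonneg (m := m) (h := h + 1) hh x.2
  have h2 := R.env.optValue_le (m := m) (h := h + 1) hh x.2
  have h3 : (0 : ℝ) ≤ ((h + 1 : ℕ) : ℝ) := Nat.cast_nonneg _
  exact ⟨by linarith [hx.1], by linarith [hx.2]⟩

theorem integral_target [NeZero A] {m h : ℕ} (s : Fin S) (a : Fin A) :
    ∫ x, (x.1 + R.env.optValue R.H m (h + 1) x.2)
      ∂(R.env.outcome m h s a : Measure (ℝ × Fin S)) = R.env.optQ R.H m h s a := by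
  rw [integral_add, integral_next]
  · rfl
  · exact Integrable.of_mem_Icc 0 1 measurable_fst.aemeasurable (R.env.reward_mem m h s a)
  · refine Integrable.of_bound (((measurable_of_countable
      (R.env.optValue R.H m (h + 1))).comp measurable_snd).aestronglyMeasurable)
      (∑ x, |R.env.optValue R.H m (h + 1) x|) (Filter.Eventually.of_forall fun x => ?_)
    exact Finset.single_le_sum (f := fun x => |R.env.optValue R.H m (h + 1) x|)
      (fun i _ => abs_nonneg _) (Finset.mem_univ x.2)

theorem stageDeviation_tail [NeZero A] {h : ℕ} (hh : h < R.H) (s : Fin S) (a : Fin A) (d j : ℕ)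
    (hι : 0 < R.ι) :
    R.env.noise {ω | ((R.H : ℝ) + 1) * √(stageLength R.H j * R.ι) < |R.stageDeviation h s a d j ω| ∧
      R.stageCount h s a d j ω ≤ stageLength R.H j} ≤
      2 * ENNReal.ofReal (Real.exp (-(2 * R.ι))) := by
  have hH : 0 < R.H := by omega
  have hc : (0 : ℝ) < (R.H : ℝ) + 1 := by positivity
  have t1 := R.env.noise_tail h (fun m => R.measurable_stageVisit h s a d j m)
    (act := fun _ b => b = true) (loc := fun _ => (s, a))
    (f := fun m _ x => x.1 + R.env.optValue R.H m (h + 1) x.2)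
    (fun m _ => R.measurable_target m (h + 1)) hc
    (fun m _ _ => R.target_mem hh s a) R.M (stageLength R.H j) (stageLength_pos R.H j hH) hι
  -- The lower tail is the upper tail of the negated target, whose range starts at `-(H + 1)`.
  have t2 := R.env.noise_tail h (fun m => R.measurable_stageVisit h s a d j m)
    (act := fun _ b => b = true) (loc := fun _ => (s, a))
    (f := fun m _ x => -(x.1 + R.env.optValue R.H m (h + 1) x.2)) (a := -((R.H : ℝ) + 1))
    (fun m _ => (R.measurable_target m (h + 1)).neg) hc
    (fun m _ _ => (R.target_mem hh s a).mono fun x hx =>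
      ⟨by linarith [hx.2], by linarith [hx.1]⟩)
    R.M (stageLength R.H j) (stageLength_pos R.H j hH) hι
  simp only [decide_eq_true_eq, integral_neg, integral_target] at t1 t2
  rw [two_mul]
  refine le_trans (measure_mono fun ω hω => ?_) ((measure_union_le _ _).trans (add_le_add t1 t2))
  have e : ∀ m, R.StageVisit h s a d j m ω → ω (m, h, s, a) = (R.rew ω m h, R.st ω m (h + 1)) := by
    rintro m ⟨-, h1, h2, -⟩
    rw [rew, st_succ, h1, h2]
  obtain ⟨w1, w2⟩ := hω
  rcases lt_abs.1 w1 with w1 | w1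
  · left
    refine ⟨w1.trans_eq (Finset.sum_congr rfl fun m _ => ?_), w2⟩
    split_ifs with hv
    · rw [e m hv]
    · rfl
  · right
    refine ⟨w1.trans_eq ?_, w2⟩
    rw [stageDeviation, ← Finset.sum_neg_distrib]
    refine Finset.sum_congr rfl fun m _ => ?_
    split_ifs with hv
    · rw [e m hv]; ring
    · ring

/-- Extension of a policy on the first `H` steps. -/
def extendPolicy [NeZero A] (H : ℕ) (π : Fin H → Fin S → Fin A) : ℕ → Fin S → Fin A :=
  fun k s => if h : k < H then π ⟨k, h⟩ s else 0

/-- Only the first `H` steps of a policy matter for its value, so the policy can be recorded in a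
finite type, as `noise_tail` requires of the predictable data. -/
theorem gap_eq [NeZero A] (ω : ℕ × ℕ × Fin S × Fin A → ℝ × Fin S) (m h : ℕ) (s : Fin S) :
    R.gap ω m h s = R.env.optValue R.H m h s -
      R.env.value R.H m (extendPolicy R.H fun k => R.pol ω m k) h s := by
  rw [gap, R.env.value_congr (π := R.pol ω m)
    (π' := extendPolicy R.H fun k => R.pol ω m k) s fun k hk => by ext; simp [extendPolicy, hk]]

theorem gapDeviation_tail [NeZero A] {h : ℕ} (hh : h < R.H) (hM : 0 < R.M) (hι : 0 < R.ι) :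
    R.env.noise {ω | (R.H : ℝ) * √(R.M * R.ι) < R.gapDeviation h ω} ≤
      ENNReal.ofReal (Real.exp (-(2 * R.ι))) := by
  have hc : (0 : ℝ) < (R.H : ℝ) := by exact_mod_cast (by omega : 0 < R.H)
  -- The policy of an episode is fixed at its beginning, so the gap function at step `h + 1` is
  -- known before step `h` is played and only the next state is random.
  let W : ℕ → (Fin S × Fin A) × (Fin R.H → Fin S → Fin A) → Fin S → ℝ := fun m x s' =>
    R.env.optValue R.H m (h + 1) s' - R.env.value R.H m (extendPolicy R.H x.2) (h + 1) s'
  have hW : ∀ m x s', W m x s' ∈ Set.Icc (0 : ℝ) R.H := by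
    intro m x s'
    have h1 := R.env.optValue_le (m := m) (h := h + 1) hh s'
    have h2 := R.env.value_nonneg (H := R.H) (m := m) (h := h + 1) (extendPolicy R.H x.2) s'
    have h3 := R.env.value_le_optValue (H := R.H) (m := m) (h := h + 1) hh (extendPolicy R.H x.2) s'
    have h4 : (0 : ℝ) ≤ ((h + 1 : ℕ) : ℝ) := Nat.cast_nonneg _
    simp only [W]
    exact ⟨by linarith, by linarith⟩
  have hσ : ∀ m, Measurable[past S A m h] fun ω =>
      ((R.st ω m h, R.ac ω m h), fun (k : Fin R.H) (s : Fin S) => R.pol ω m k s) := by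
    intro m
    refine ((R.measurable_st m h).prodMk (R.measurable_ac m h)).prodMk ?_
    exact @measurable_pi_lambda _ _ _ (past S A m h) _ _ fun k =>
      @measurable_pi_lambda _ _ _ (past S A m h) _ _ fun s => R.measurable_pol m h k s
  have t := R.env.noise_tail h hσ (act := fun _ _ => True) (loc := fun x => x.1)
    (f := fun m x y => -W m x y.2) (a := -(R.H : ℝ))
    (fun m x => ((measurable_of_countable (W m x)).comp measurable_snd).neg) hc
    (fun m x _ => Filter.Eventually.of_forall fun y =>
      ⟨neg_le_neg (hW m x y.2).2, by linarith [(hW m x y.2).1]⟩)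
    R.M R.M hM hι
  refine le_trans (measure_mono fun ω hω => ?_) t
  refine ⟨lt_of_lt_of_eq hω ?_, by simp⟩
  refine Finset.sum_congr rfl fun m _ => ?_
  rw [if_pos trivial, integral_neg, integral_next, ← st_succ]
  simp only [R.gap_eq, W]
  ring

/-- The event on which all deviations are controlled. -/
def Good (ω : ℕ × ℕ × Fin S × Fin A → ℝ × Fin S) : Prop :=
  -- Indices below `M` cover every epoch and finished stage that can occur, which keeps the union
  -- bound finite. The count condition is always met by `stageCount_le` when `H` and `K` are
  -- positive.
  (∀ h < R.H, ∀ s a, ∀ d < R.M, ∀ j < R.M, R.stageCount h s a d j ω ≤ stageLength R.H j →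
    |R.stageDeviation h s a d j ω| ≤ ((R.H : ℝ) + 1) * √(stageLength R.H j * R.ι)) ∧
  ∀ h < R.H, R.gapDeviation h ω ≤ (R.H : ℝ) * √(R.M * R.ι)

theorem noise_not_good_le [NeZero A] (hM : 0 < R.M) (hι : 0 < R.ι) :
    R.env.noise {ω | ¬ R.Good ω} ≤
      ENNReal.ofReal (((2 * (S * A * R.H * R.M * R.M) + R.H : ℕ) : ℝ) *
        Real.exp (-(2 * R.ι))) := by
  set B : Fin R.H → Fin S → Fin A → Fin R.M → Fin R.M →
      Set (ℕ × ℕ × Fin S × Fin A → ℝ × Fin S) := fun h s a d j =>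
    {ω | ((R.H : ℝ) + 1) * √(stageLength R.H j * R.ι) < |R.stageDeviation h s a d j ω| ∧
      R.stageCount h s a d j ω ≤ stageLength R.H j} with hB
  set B' : Fin R.H → Set (ℕ × ℕ × Fin S × Fin A → ℝ × Fin S) := fun h =>
    {ω | (R.H : ℝ) * √(R.M * R.ι) < R.gapDeviation h ω} with hB'
  have hsub : {ω | ¬ R.Good ω} ⊆
      (⋃ i : Fin R.H × Fin S × Fin A × Fin R.M × Fin R.M,
        B i.1 i.2.1 i.2.2.1 i.2.2.2.1 i.2.2.2.2) ∪ ⋃ h, B' h := by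
    intro ω hω
    by_contra hcon
    simp only [Set.mem_union, Set.mem_iUnion, not_or, not_exists] at hcon
    refine hω ⟨fun h hh s a d hd j hj hcount => ?_, fun h hh => ?_⟩
    · by_contra hlt
      exact hcon.1 (⟨h, hh⟩, s, a, ⟨d, hd⟩, ⟨j, hj⟩) ⟨not_le.1 hlt, hcount⟩
    · by_contra hlt
      exact hcon.2 ⟨h, hh⟩ (not_le.1 hlt)
  set e := ENNReal.ofReal (Real.exp (-(2 * R.ι))) with he
  calc _ ≤ R.env.noise (⋃ i : Fin R.H × Fin S × Fin A × Fin R.M × Fin R.M,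
          B i.1 i.2.1 i.2.2.1 i.2.2.2.1 i.2.2.2.2) + R.env.noise (⋃ h, B' h) :=
        (measure_mono hsub).trans (measure_union_le _ _)
    _ ≤ (∑ _i : Fin R.H × Fin S × Fin A × Fin R.M × Fin R.M, 2 * e) + ∑ _h : Fin R.H, e := by
        gcongr
        · refine (measure_iUnion_fintype_le _ _).trans (Finset.sum_le_sum fun i _ => ?_)
          exact R.stageDeviation_tail i.1.2 _ _ _ _ hι
        · refine (measure_iUnion_fintype_le _ _).trans (Finset.sum_le_sum fun h _ => ?_)
          exact R.gapDeviation_tail h.2 hM hι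
    _ = ((2 * (S * A * R.H * R.M * R.M) + R.H : ℕ) : ENNReal) * e := by
        simp only [Finset.sum_const, Finset.card_univ, Fintype.card_prod, Fintype.card_fin,
          nsmul_eq_mul]
        push_cast
        ring
    _ = _ := by
        rw [ENNReal.ofReal_mul (Nat.cast_nonneg _), ENNReal.ofReal_natCast]

end Run

theorem stageIndex_le (H n : ℕ) (hH : 0 < H) : stageIndex H n ≤ n :=
  ((stageStart_strictMono H hH).le_apply).trans (stageIndex_spec H n hH).1

namespace Run

open NonstationaryMDP

variable {S A : ℕ} (R : Run S A) (ω : ℕ × ℕ × Fin S × Fin A → ℝ × Fin S)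

/-! ### Sums over stages -/

theorem cnt_mono (h : ℕ) (s : Fin S) (a : Fin A) (d : ℕ) : Monotone (R.cnt ω h s a d) :=
  Nat.count_monotone _

theorem cnt_le (h : ℕ) (s : Fin S) (a : Fin A) (d m : ℕ) : R.cnt ω h s a d m ≤ m :=
  Nat.count_le _

/-- A finished stage receives no further visits; totals up to the current episode and up to the end
therefore agree. -/
theorem stageTotal_stable (h : ℕ) (s : Fin S) (a : Fin A) {d j m m' : ℕ} (hm : m ≤ m')
    (hj : j < stageIndex R.H (R.cnt ω h s a d m)) {E : Type} [AddCommMonoid E] (x : ℕ → E) :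
    R.stageTotal ω h s a d j m' x = R.stageTotal ω h s a d j m x := by
  induction m', hm using Nat.le_induction with
  | base => rfl
  | succ n hn ih =>
    have h1 := stageIndex_mono R.H (R.cnt_mono ω h s a d hn)
    rw [stageTotal_succ, ih, if_neg (c := stageIndex _ _ = _) (by omega), ite_self, add_zero]

theorem stageTotal_add (h : ℕ) (s : Fin S) (a : Fin A) (d j m : ℕ) (x y : ℕ → ℝ) :
    R.stageTotal ω h s a d j m (fun l => x l + y l) =
      R.stageTotal ω h s a d j m x + R.stageTotal ω h s a d j m y := by
  rw [stageTotal, stageTotal, stageTotal, ← Finset.sum_add_distrib]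
  refine Finset.sum_congr rfl fun l _ => ?_
  split_ifs <;> simp

theorem stageTotal_le (h : ℕ) (s : Fin S) (a : Fin A) (d j m : ℕ) {x y : ℕ → ℝ}
    (hxy : ∀ l < m, R.Visit ω h s a d l → x l ≤ y l) :
    R.stageTotal ω h s a d j m x ≤ R.stageTotal ω h s a d j m y := by
  refine Finset.sum_le_sum fun l hl => ?_
  split_ifs with h1
  · exact hxy l (Finset.mem_range.1 hl) h1
  · exact le_rfl
  · exact le_rfl

theorem stageTotal_const (hH : 0 < R.H) (h : ℕ) (s : Fin S) (a : Fin A) {d j m : ℕ}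
    (hj : j < stageIndex R.H (R.cnt ω h s a d m)) (c : ℝ) :
    R.stageTotal ω h s a d j m (fun _ => c) = stageLength R.H j * c := by
  rw [← card_stage_eq R.H _ j hH hj, ← stageTotal_one, stageTotal, stageTotal, Nat.cast_sum,
    Finset.sum_mul]
  refine Finset.sum_congr rfl fun l _ => ?_
  split_ifs <;> simp

theorem stageVisit_iff (hH : 0 < R.H) (hK : 0 < R.K) {h : ℕ} (hh : h < R.H) (s : Fin S)
    (a : Fin A) (d j l : ℕ) : R.StageVisit h s a d j l ω ↔
      R.Visit ω h s a d l ∧ stageIndex R.H (R.cnt ω h s a d l) = j := by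
  unfold StageVisit Visit
  rw [(R.invariant ω hH hK hh s a l).N_eq]
  constructor
  · rintro ⟨rfl, h1, h2, h3⟩; exact ⟨⟨rfl, h1, h2⟩, h3⟩
  · rintro ⟨⟨rfl, h1, h2⟩, h3⟩; exact ⟨rfl, h1, h2, h3⟩

theorem stageCount_le (hH : 0 < R.H) (hK : 0 < R.K) {h : ℕ} (hh : h < R.H) (s : Fin S)
    (a : Fin A) (d j : ℕ) : R.stageCount h s a d j ω ≤ stageLength R.H j := by
  refine le_trans (le_of_eq ?_) (card_stage_le R.H (R.cnt ω h s a d R.M) j hH)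
  rw [← stageTotal_one, stageCount, stageTotal]
  refine Finset.sum_congr rfl fun l _ => ?_
  simp only [R.stageVisit_iff ω hH hK hh, ite_and]

theorem stageDeviation_eq (hH : 0 < R.H) (hK : 0 < R.K) {h : ℕ} (hh : h < R.H) (s : Fin S)
    (a : Fin A) (d j : ℕ) : R.stageDeviation h s a d j ω =
      R.stageTotal ω h s a d j R.M (fun m => R.rew ω m h +
        R.env.optValue R.H m (h + 1) (R.st ω m (h + 1)) - R.env.optQ R.H m h s a) := by
  rw [stageDeviation, stageTotal]
  refine Finset.sum_congr rfl fun l _ => ?_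
  simp only [R.stageVisit_iff ω hH hK hh, ite_and]

variable {ω}

/-- Each sample is centered at `Q⋆` of its own episode; moving the center to episode `m` of the same
epoch costs `b_Δ` per visit, and the stage has exactly `stageLength R.H j` visits. -/
theorem abs_stageTotal_target_sub_le [NeZero A] (hH : 0 < R.H) (hK : 0 < R.K) (hω : R.Good ω)
    {h m j : ℕ} (hh : h < R.H) (hm : m < R.M) (s : Fin S) (a : Fin A)
    (hj : j < stageIndex R.H (R.cnt ω h s a (m / R.K) m)) :
    |R.stageTotal ω h s a (m / R.K) j m (fun l => R.rew ω l h +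
        R.env.optValue R.H l (h + 1) (R.st ω l (h + 1))) -
        stageLength R.H j * R.env.optQ R.H m h s a| ≤
      ((R.H : ℝ) + 1) * √(stageLength R.H j * R.ι) +
        stageLength R.H j * R.bonus (m / R.K) := by
  set d := m / R.K with hd
  -- The stage index is at most the number of visits, hence at most `m`.
  have hjM : j < R.M := by
    have := stageIndex_le R.H (R.cnt ω h s a d m) hH
    have := R.cnt_le ω h s a d m
    omega
  have hdM : d < R.M := (Nat.div_le_self _ _).trans_lt hm
  have h1 := hω.1 h hh s a d hdM j hjM (R.stageCount_le ω hH hK hh s a d j)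
  rw [R.stageDeviation_eq ω hH hK hh, R.stageTotal_stable ω h s a hm.le hj] at h1
  set q := R.env.optQ R.H m h s a
  set b := R.bonus d
  have hq : ∀ l < m, R.Visit ω h s a d l → |R.env.optQ R.H l h s a - q| ≤ b := by
    intro l hl hv
    have := R.env.abs_optQ_sub_le hK hh (hl.trans hm) hm hv.1 s a
    rwa [hv.1] at this
  have e : ∀ c : ℝ, R.stageTotal ω h s a d j m (fun l => R.rew ω l h +
        R.env.optValue R.H l (h + 1) (R.st ω l (h + 1)) - R.env.optQ R.H l h s a) +
        stageLength R.H j * c =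
      R.stageTotal ω h s a d j m (fun l => (R.rew ω l h +
        R.env.optValue R.H l (h + 1) (R.st ω l (h + 1)) - R.env.optQ R.H l h s a) + c) := by
    intro c
    rw [stageTotal_add, R.stageTotal_const ω hH h s a hj]
  have up := R.stageTotal_le ω h s a d j m (x := fun l => R.rew ω l h +
        R.env.optValue R.H l (h + 1) (R.st ω l (h + 1))) (y := fun l => (R.rew ω l h +
        R.env.optValue R.H l (h + 1) (R.st ω l (h + 1)) - R.env.optQ R.H l h s a) + (q + b))
    fun l hl hv => by linarith [(abs_le.1 (hq l hl hv)).2]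
  have lo := R.stageTotal_le ω h s a d j m (y := fun l => R.rew ω l h +
        R.env.optValue R.H l (h + 1) (R.st ω l (h + 1))) (x := fun l => (R.rew ω l h +
        R.env.optValue R.H l (h + 1) (R.st ω l (h + 1)) - R.env.optQ R.H l h s a) + (q - b))
    fun l hl hv => by linarith [(abs_le.1 (hq l hl hv)).1]
  rw [← e] at up lo
  have h2 := abs_le.1 h1
  rw [abs_le]
  constructor <;> linarith

/-- The two bonuses add up to exactly the Hoeffding deviation per sample for range `H + 1`; with
`deviation_div_eq` this lets bonus and deviation cancel. -/
theorem bonus_eq (H j : ℕ) (hH : 0 < H) (ι : ℝ) :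
    √((H : ℝ) ^ 2 / stageLength H j * ι) + √(1 / stageLength H j * ι) =
      ((H : ℝ) + 1) * √ι * (1 / √(stageLength H j : ℝ)) := by
  have he : (0 : ℝ) ≤ stageLength H j := Nat.cast_nonneg _
  rw [Real.sqrt_mul (by positivity), Real.sqrt_mul (by positivity), Real.sqrt_div (by positivity),
    Real.sqrt_div (by positivity), Real.sqrt_sq (by positivity), Real.sqrt_one]
  ring

theorem deviation_div_eq (H j : ℕ) (hH : 0 < H) (ι : ℝ) :
    ((H : ℝ) + 1) * √(stageLength H j * ι) =
      stageLength H j * (((H : ℝ) + 1) * √ι * (1 / √(stageLength H j : ℝ))) := by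
  have he : (0 : ℝ) < stageLength H j := by exact_mod_cast stageLength_pos H j hH
  have h1 : √(stageLength H j : ℝ) * √(stageLength H j : ℝ) = stageLength H j :=
    Real.mul_self_sqrt he.le
  have h2 : 0 < √(stageLength H j : ℝ) := Real.sqrt_pos.2 he
  have h3 : (stageLength H j : ℝ) * (1 / √(stageLength H j : ℝ)) = √(stageLength H j : ℝ) := by
    rw [mul_one_div, div_eq_iff h2.ne', h1]
  rw [Real.sqrt_mul he.le]
  linear_combination -(((H : ℝ) + 1) * √ι) * h3

/-- The excess of the optimistic value over the optimal value along the path. -/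
def excess (ω : ℕ × ℕ × Fin S × Fin A → ℝ × Fin S) (h m : ℕ) : ℝ :=
  (R.mem ω m).V h (R.st ω m h) - R.env.optValue R.H m h (R.st ω m h)

theorem stageTotal_sample (h : ℕ) (s : Fin S) (a : Fin A) (d j m : ℕ) :
    R.stageTotal ω h s a d j m (R.sample ω h) =
      R.stageTotal ω h s a d j m (fun l => R.rew ω l h +
        R.env.optValue R.H l (h + 1) (R.st ω l (h + 1))) +
      R.stageTotal ω h s a d j m (R.excess ω (h + 1)) := by
  rw [← stageTotal_add]
  congr 1
  ext l
  rw [sample, excess]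
  ring

/-- The samples exceed their versions with `V⋆` by the assumed optimism at the next step, the
Hoeffding bonus absorbs the noise, and one of the two copies of `b_Δ` absorbs the drift. -/
theorem optQ_le_Q [NeZero A] (hH : 0 < R.H) (hK : 0 < R.K) (hω : R.Good ω) {h : ℕ} (hh : h < R.H)
    (hV : ∀ l < R.M, ∀ s, R.env.optValue R.H l (h + 1) s ≤ (R.mem ω l).V (h + 1) s)
    {m : ℕ} (hm : m < R.M) (s : Fin S) (a : Fin A) :
    R.env.optQ R.H m h s a ≤ (R.mem ω m).Q h s a := by
  refine (R.invariant ω hH hK hh s a m).le_Q _ (R.env.optQ_le hh s a) fun j hj => ?_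
  have h1 := (abs_le.1 (R.abs_stageTotal_target_sub_le hH hK hω hh hm s a hj)).1
  have h2 : 0 ≤ R.stageTotal ω h s a (m / R.K) j m (R.excess ω (h + 1)) := by
    have := R.stageTotal_le ω h s a (m / R.K) j m (x := fun _ => 0) (y := R.excess ω (h + 1))
      fun l hl _ => sub_nonneg.2 (hV l (hl.trans hm) _)
    rwa [R.stageTotal_const ω hH h s a hj, mul_zero] at this
  have he : (0 : ℝ) < stageLength R.H j := by exact_mod_cast stageLength_pos R.H j hH
  have hb : 0 ≤ R.bonus (m / R.K) := R.env.bonusDelta_nonneg _ _ _ _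
  rw [estimate, bonus_eq _ _ hH, stageTotal_sample]
  rw [deviation_div_eq _ _ hH] at h1
  rw [add_assoc, ← sub_le_iff_le_add, le_div_iff₀ he]
  nlinarith

theorem optValue_le_V [NeZero A] (hH : 0 < R.H) (hK : 0 < R.K) (hω : R.Good ω) {k : ℕ}
    (hk : k ≤ R.H) {m : ℕ} (hm : m < R.M) (s : Fin S) :
    R.env.optValue R.H m (R.H - k) s ≤ (R.mem ω m).V (R.H - k) s := by
  induction k generalizing m s with
  | zero => rw [Nat.sub_zero, optValue_self, V_last]
  | succ k ih =>
    have hlt : R.H - (k + 1) < R.H := by omega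
    rw [R.env.optValue_eq hlt, R.V_eq ω hlt]
    refine ciSup_mono (Set.finite_range _).bddAbove fun a => ?_
    refine R.optQ_le_Q hH hK hω hlt (fun l hl s => ?_) hm s a
    rw [show R.H - (k + 1) + 1 = R.H - k by omega]
    exact ih (by omega) hl s

theorem excess_nonneg [NeZero A] (hH : 0 < R.H) (hK : 0 < R.K) (hω : R.Good ω) {h : ℕ}
    (hh : h ≤ R.H) {m : ℕ} (hm : m < R.M) : 0 ≤ R.excess ω h m := by
  have := R.optValue_le_V hH hK hω (k := R.H - h) (by omega) hm (R.st ω m h)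
  rw [show R.H - (R.H - h) = h by omega] at this
  exact sub_nonneg.2 this

/-- The number of earlier visits, in the same epoch, to the current state-action pair. -/
def rank (ω : ℕ × ℕ × Fin S × Fin A → ℝ × Fin S) (h m : ℕ) : ℕ :=
  R.cnt ω h (R.st ω m h) (R.ac ω m h) (m / R.K) m

/-- The average excess over the previous stage. -/
def previousExcess (ω : ℕ × ℕ × Fin S × Fin A → ℝ × Fin S) (h : ℕ) (s : Fin S) (a : Fin A)
    (d k : ℕ) : ℝ :=
  -- No estimate exists during a first stage; its cost is charged separately as `H` in
  -- `Q_sub_optQ_le`.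
  if stageIndex R.H k = 0 then 0 else
    R.stageTotal ω h s a d (stageIndex R.H k - 1) R.M (R.excess ω (h + 1)) /
      stageLength R.H (stageIndex R.H k - 1)

/-- `Q` is at most the estimate of the previous stage. The bonus and the deviation contribute equal
amounts, hence the factor `2`; two copies of `b_Δ` come from the bonus and one from the drift. -/
theorem Q_sub_optQ_le [NeZero A] (hH : 0 < R.H) (hK : 0 < R.K) (hω : R.Good ω) {h : ℕ}
    (hh : h < R.H) {m : ℕ} (hm : m < R.M) (s : Fin S) (a : Fin A) :
    (R.mem ω m).Q h s a - R.env.optQ R.H m h s a ≤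
      3 * R.bonus (m / R.K) +
      R.H * (if stageIndex R.H (R.cnt ω h s a (m / R.K) m) = 0 then 1 else 0) +
      2 * (((R.H : ℝ) + 1) * √R.ι) *
        (if stageIndex R.H (R.cnt ω h s a (m / R.K) m) = 0 then (0 : ℝ)
          else 1 / √(stageLength R.H (stageIndex R.H (R.cnt ω h s a (m / R.K) m) - 1) : ℝ)) +
      R.previousExcess ω h s a (m / R.K) (R.cnt ω h s a (m / R.K) m) := by
  have hb : 0 ≤ R.bonus (m / R.K) := R.env.bonusDelta_nonneg _ _ _ _
  have inv := R.invariant ω hH hK hh s a m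
  unfold previousExcess
  split_ifs with h0
  · have h1 := inv.Q_le
    have h2 : 0 ≤ R.env.optQ R.H m h s a := by
      refine add_nonneg (R.env.r_mem _ _ _ _).1 (Finset.sum_nonneg fun x _ => ?_)
      exact mul_nonneg (R.env.P_nonneg _ _ _ _ _) (R.env.optValue_nonneg hh _)
    have h3 : (0 : ℝ) ≤ h := Nat.cast_nonneg _
    linarith
  · obtain ⟨j, hj⟩ := Nat.exists_eq_succ_of_ne_zero h0
    have hj' : j < stageIndex R.H (R.cnt ω h s a (m / R.K) m) := by omega
    rw [hj, Nat.succ_eq_add_one, Nat.add_sub_cancel, R.stageTotal_stable ω h s a hm.le hj']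
    have h1 := (abs_le.1 (R.abs_stageTotal_target_sub_le hH hK hω hh hm s a hj')).2
    have he : (0 : ℝ) < stageLength R.H j := by exact_mod_cast stageLength_pos R.H j hH
    have h2 := inv.Q_le_estimate j hj'
    rw [estimate, bonus_eq _ _ hH, stageTotal_sample, add_div] at h2
    rw [deviation_div_eq _ _ hH, sub_le_iff_le_add, ← mul_add, ← mul_add, ← div_le_iff₀' he] at h1
    linarith

/-! ### Sums over the path -/

/-- At a fixed step, each episode visits exactly one pair in exactly one epoch. -/
theorem sum_visits (h : ℕ) {n E : ℕ} (hE : ∀ m < n, m / R.K < E)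
    (F : Fin S → Fin A → ℕ → ℕ → ℝ) :
    ∑ m ∈ Finset.range n, F (R.st ω m h) (R.ac ω m h) (m / R.K) m =
      ∑ i : Fin E × Fin S × Fin A, ∑ m ∈ Finset.range n,
        if R.Visit ω h i.2.1 i.2.2 i.1 m then F i.2.1 i.2.2 i.1 m else 0 := by
  rw [Finset.sum_comm]
  refine Finset.sum_congr rfl fun m hm => ?_
  have hmE := hE m (Finset.mem_range.1 hm)
  rw [Finset.sum_eq_single ((⟨m / R.K, hmE⟩, R.st ω m h, R.ac ω m h) : Fin E × Fin S × Fin A)]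
  · rw [if_pos ⟨rfl, rfl, rfl⟩]
  · rintro ⟨d, s, a⟩ _ hne
    rw [if_neg]
    rintro ⟨h1, h2, h3⟩
    exact hne (by ext1; exacts [Fin.ext h1.symm, by ext1; exacts [h2.symm, h3.symm]])
  · exact fun hn => absurd (Finset.mem_univ _) hn

theorem sum_rank_eq (h : ℕ) {n E : ℕ} (hE : ∀ m < n, m / R.K < E)
    (f : Fin S → Fin A → ℕ → ℕ → ℝ) :
    ∑ m ∈ Finset.range n, f (R.st ω m h) (R.ac ω m h) (m / R.K) (R.rank ω h m) =
      ∑ i : Fin E × Fin S × Fin A, ∑ k ∈ Finset.range (R.cnt ω h i.2.1 i.2.2 i.1 n),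
        f i.2.1 i.2.2 i.1 k := by
  refine (R.sum_visits h hE fun s a d m => f s a d (R.cnt ω h s a d m)).trans ?_
  refine Finset.sum_congr rfl fun i _ => ?_
  exact sum_rank (R.Visit ω h i.2.1 i.2.2 i.1) (f i.2.1 i.2.2 i.1) n

theorem sum_first_stage_le (hH : 0 < R.H) (h : ℕ) {n E : ℕ} (hE : ∀ m < n, m / R.K < E) :
    ∑ m ∈ Finset.range n, (if stageIndex R.H (R.rank ω h m) = 0 then (1 : ℝ) else 0) ≤
      E * (S * A) * R.H := by
  refine (R.sum_rank_eq h hE fun _ _ _ k => if stageIndex R.H k = 0 then (1 : ℝ) else 0).trans_le ?_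
  refine (Finset.sum_le_card_nsmul _ _ (R.H : ℝ) fun i _ => ?_).trans_eq ?_
  · have := card_stage_le R.H (R.cnt ω h i.2.1 i.2.2 i.1 n) 0 hH
    exact_mod_cast this
  · simp [mul_assoc]

theorem sum_bonus_le (hH : 0 < R.H) (h : ℕ) {n E : ℕ} (hE : ∀ m < n, m / R.K < E) :
    ∑ m ∈ Finset.range n, (if stageIndex R.H (R.rank ω h m) = 0 then (0 : ℝ)
        else 1 / √(stageLength R.H (stageIndex R.H (R.rank ω h m) - 1) : ℝ)) ≤
      2 * √(5 * R.H) * √(E * (S * A) * n) := by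
  refine (R.sum_rank_eq h hE fun _ _ _ k => if stageIndex R.H k = 0 then (0 : ℝ)
        else 1 / √(stageLength R.H (stageIndex R.H k - 1) : ℝ)).trans_le ?_
  refine (Finset.sum_le_sum fun i _ => sum_stage_bonus_le R.H _ hH).trans ?_
  rw [← Finset.mul_sum]
  -- Cauchy–Schwarz over the `E S A` cells, whose visit counts add up to `n`.
  refine mul_le_mul_of_nonneg_left (Real.le_sqrt_of_sq_le ?_) (by positivity)
  refine sq_sum_le_card_mul_sum_sq.trans ?_
  simp_rw [Real.sq_sqrt (Nat.cast_nonneg _)]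
  have h1 : ∑ i : Fin E × Fin S × Fin A, (R.cnt ω h i.2.1 i.2.2 i.1 n : ℝ) = n := by
    have := R.sum_rank_eq (ω := ω) h hE fun _ _ _ _ => 1
    simpa using this.symm
  rw [h1]
  simp

/-- Stage `j + 1` has at most `(1 + 1/H) e_j` visits, each charged `τ j / e_j`. This is where the
geometric growth rate of the stages is used. -/
theorem sum_stage_ratio_le (hH : 0 < R.H) {n N : ℕ} (hn : n ≤ N) {τ : ℕ → ℝ} (hτ : ∀ j, 0 ≤ τ j) :
    ∑ k ∈ Finset.range n, (if stageIndex R.H k = 0 then (0 : ℝ) else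
      τ (stageIndex R.H k - 1) / stageLength R.H (stageIndex R.H k - 1)) ≤
      (1 + 1 / (R.H : ℝ)) * ∑ j ∈ Finset.range N, τ j := by
  have e : ∀ k ∈ Finset.range n, (if stageIndex R.H k = 0 then (0 : ℝ) else
      τ (stageIndex R.H k - 1) / stageLength R.H (stageIndex R.H k - 1)) =
      ∑ j ∈ Finset.range N, (if stageIndex R.H k = j + 1 then 1 else 0) *
        (τ j / stageLength R.H j) := by
    intro k hk
    have hk' := stageIndex_le R.H k hH
    rw [Finset.mem_range] at hk
    split_ifs with h0
    · rw [h0]; simp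
    · rw [Finset.sum_eq_single (stageIndex R.H k - 1)]
      · rw [if_pos (by omega), one_mul]
      · intro j _ hj; rw [if_neg (by omega), zero_mul]
      · intro hj; rw [Finset.mem_range] at hj; omega
  rw [Finset.sum_congr rfl e, Finset.sum_comm, Finset.mul_sum]
  refine Finset.sum_le_sum fun j _ => ?_
  rw [← Finset.sum_mul]
  have he : (0 : ℝ) < stageLength R.H j := by exact_mod_cast stageLength_pos R.H j hH
  have h1 : (∑ k ∈ Finset.range n, if stageIndex R.H k = j + 1 then (1 : ℝ) else 0) ≤
      stageLength R.H (j + 1) := by exact_mod_cast card_stage_le R.H n (j + 1) hH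
  have h2 := h1.trans (stageLength_succ_le R.H j)
  calc _ ≤ (1 + 1 / (R.H : ℝ)) * stageLength R.H j * (τ j / stageLength R.H j) :=
        mul_le_mul_of_nonneg_right h2 (div_nonneg (hτ j) he.le)
    _ = _ := by field_simp

theorem sum_previousExcess_le [NeZero A] (hH : 0 < R.H) (hK : 0 < R.K) (hω : R.Good ω) {h E : ℕ}
    (hh : h < R.H) (hE : ∀ m < R.M, m / R.K < E) :
    ∑ m ∈ Finset.range R.M,
        R.previousExcess ω h (R.st ω m h) (R.ac ω m h) (m / R.K) (R.rank ω h m) ≤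
      (1 + 1 / (R.H : ℝ)) * ∑ m ∈ Finset.range R.M, R.excess ω (h + 1) m := by
  have hx : ∀ m ∈ Finset.range R.M, 0 ≤ R.excess ω (h + 1) m := fun m hm =>
    R.excess_nonneg hH hK hω hh (Finset.mem_range.1 hm)
  rw [R.sum_rank_eq h hE (R.previousExcess ω h),
    R.sum_visits (ω := ω) h hE fun _ _ _ m => R.excess ω (h + 1) m, Finset.mul_sum]
  refine Finset.sum_le_sum fun i _ => ?_
  refine (R.sum_stage_ratio_le hH (R.cnt_le ω h i.2.1 i.2.2 i.1 R.M)
    (τ := fun j => R.stageTotal ω h i.2.1 i.2.2 i.1 j R.M (R.excess ω (h + 1)))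
    fun j => ?_).trans ?_
  · refine Finset.sum_nonneg fun l hl => ?_
    split_ifs
    · exact hx l hl
    · exact le_rfl
    · exact le_rfl
  · refine mul_le_mul_of_nonneg_left ?_ (by positivity)
    unfold stageTotal
    rw [Finset.sum_comm]
    refine Finset.sum_le_sum fun l hl => ?_
    split_ifs
    · rw [Finset.sum_ite_eq]
      split_ifs
      · exact le_rfl
      · exact hx l hl
    · simp

/-- The factor `K - 1` instead of `K` absorbs the rounding in `K = ⌈M / D⌉`, since `K - 1 ≤ M / D`
even when `D` exceeds `M`. -/
theorem sum_bonusDelta_le {E : ℕ} (hK : 0 < R.K) (hE : ∀ m < R.M, m / R.K < E) (hH : 0 < R.H) :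
    ∑ m ∈ Finset.range R.M, R.bonus (m / R.K) ≤
      2 * ((R.K : ℝ) - 1) * (R.H * R.env.variation R.H R.M) := by
  have hb : ∀ d, 0 ≤ R.bonus d := fun d => R.env.bonusDelta_nonneg _ _ _ _
  have hK1 : (1 : ℝ) ≤ R.K := by exact_mod_cast hK
  set x : ℕ → ℝ := fun m => R.env.rewardStep R.H m + R.H * R.env.transStep R.H m with hxdef
  have hx : ∀ m, 0 ≤ x m := fun m => add_nonneg (R.env.rewardStep_nonneg _ _)
    (mul_nonneg (Nat.cast_nonneg _) (R.env.transStep_nonneg _ _))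
  have hfib : ∀ d m, m / R.K = d ↔ d * R.K ≤ m ∧ m < (d + 1) * R.K := by
    intro d m
    rw [Nat.div_eq_iff hK]
    have : (d + 1) * R.K = d * R.K + R.K := by ring
    omega
  have h1 : ∑ m ∈ Finset.range R.M, R.bonus (m / R.K) ≤
      ∑ d ∈ Finset.range E, R.K * R.bonus d := by
    rw [← Finset.sum_fiberwise_of_maps_to (t := Finset.range E) (g := fun m => m / R.K)
      fun m hm => Finset.mem_range.2 (hE m (Finset.mem_range.1 hm))]
    refine Finset.sum_le_sum fun d _ => ?_
    rw [Finset.sum_congr rfl (g := fun _ => R.bonus d)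
      fun m hm => by rw [(Finset.mem_filter.1 hm).2]]
    rw [Finset.sum_const, nsmul_eq_mul]
    refine mul_le_mul_of_nonneg_right ?_ (hb d)
    have : ((Finset.range R.M).filter fun m => m / R.K = d).card ≤
        (Finset.Ico (d * R.K) ((d + 1) * R.K)).card := by
      refine Finset.card_le_card fun m hm => ?_
      rw [Finset.mem_Ico]
      exact (hfib d m).1 (Finset.mem_filter.1 hm).2
    rw [Nat.card_Ico, show (d + 1) * R.K = d * R.K + R.K by ring, Nat.add_sub_cancel_left] at this
    exact_mod_cast this
  -- For `K ≥ 2` one has `K ≤ 2 (K - 1)`; for `K = 1` an epoch contains no consecutive pair of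
  -- episodes and its bonus vanishes.
  have h2 : ∀ d, R.K * R.bonus d ≤ 2 * ((R.K : ℝ) - 1) * R.bonus d := by
    intro d
    rcases Nat.lt_or_ge 1 R.K with hK2 | hK2
    · refine mul_le_mul_of_nonneg_right ?_ (hb d)
      have : (2 : ℝ) ≤ R.K := by exact_mod_cast hK2
      linarith
    · have hK3 : R.K = 1 := by omega
      have : R.bonus d = 0 := by
        rw [bonus, bonusDelta_eq, Finset.Ico_eq_empty, Finset.sum_empty]
        rw [hK3]
        omega
      rw [this, mul_zero, mul_zero]
  have h3 : ∑ d ∈ Finset.range E, R.bonus d ≤ ∑ m ∈ Finset.range (R.M - 1), x m := by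
    rw [← Finset.sum_fiberwise_of_maps_to (s := Finset.range (R.M - 1)) (t := Finset.range E)
      (g := fun m => m / R.K) (fun m hm => Finset.mem_range.2
        (hE m (by rw [Finset.mem_range] at hm; omega)))]
    refine Finset.sum_le_sum fun d _ => ?_
    rw [bonus, bonusDelta_eq]
    refine Finset.sum_le_sum_of_subset_of_nonneg (fun m hm => ?_) fun m _ _ => hx m
    rw [Finset.mem_Ico] at hm
    rw [Finset.mem_filter, Finset.mem_range, hfib]
    omega
  have h4 : ∑ m ∈ Finset.range (R.M - 1), x m ≤ R.H * R.env.variation R.H R.M := by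
    have hH1 : (1 : ℝ) ≤ R.H := by exact_mod_cast hH
    have h5 : 0 ≤ ∑ m ∈ Finset.range (R.M - 1), R.env.rewardStep R.H m :=
      Finset.sum_nonneg fun m _ => R.env.rewardStep_nonneg _ _
    simp only [hxdef, variation, Finset.sum_add_distrib, ← Finset.mul_sum]
    nlinarith
  calc _ ≤ ∑ d ∈ Finset.range E, 2 * ((R.K : ℝ) - 1) * R.bonus d :=
        h1.trans (Finset.sum_le_sum fun d _ => h2 d)
    _ = 2 * ((R.K : ℝ) - 1) * ∑ d ∈ Finset.range E, R.bonus d := by rw [Finset.mul_sum]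
    _ ≤ _ := mul_le_mul_of_nonneg_left (h3.trans h4) (by linarith)

/-! ### The regret on the good event -/

/-- The excess of the optimistic value over the value of the policy along the path. -/
def shortfall (ω : ℕ × ℕ × Fin S × Fin A → ℝ × Fin S) (h m : ℕ) : ℝ :=
  (R.mem ω m).V h (R.st ω m h) - R.env.value R.H m (R.pol ω m) h (R.st ω m h)

/-- For the greedy action `V ≤ Q`, and `Q - V^π` is `Q - Q⋆` plus the mean next gap. The mean is
replaced by the realized gap, which is shortfall minus excess, at the price of a martingale
difference. -/
theorem shortfall_le [NeZero A] {h : ℕ} (hh : h < R.H) (m : ℕ) :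
    R.shortfall ω h m ≤
      ((R.mem ω m).Q h (R.st ω m h) (R.ac ω m h) -
        R.env.optQ R.H m h (R.st ω m h) (R.ac ω m h)) +
      (∑ s', R.env.P m h (R.st ω m h) (R.ac ω m h) s' * R.gap ω m (h + 1) s' -
        R.gap ω m (h + 1) (R.st ω m (h + 1))) +
      (R.shortfall ω (h + 1) m - R.excess ω (h + 1) m) := by
  have : Nonempty (Fin A) := ⟨0⟩
  have h1 : (R.mem ω m).V h (R.st ω m h) ≤ (R.mem ω m).Q h (R.st ω m h) (R.ac ω m h) := by
    rw [R.V_eq ω hh, R.ac_eq]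
    exact ciSup_le fun a => R.g.le_pick m h _ _ a
  have h2 := R.env.value_eq (m := m) (R.pol ω m) (R.st ω m h) hh
  rw [← ac_eq_pol] at h2
  simp only [shortfall, excess, gap, optQ, mul_sub, Finset.sum_sub_distrib]
  linarith

theorem sum_shortfall_step [NeZero A] (hH : 0 < R.H) (hK : 0 < R.K) (hω : R.Good ω) {h E : ℕ}
    (hh : h < R.H) (hE : ∀ m < R.M, m / R.K < E) :
    ∑ m ∈ Finset.range R.M, R.shortfall ω h m ≤
      (6 * ((R.K : ℝ) - 1) * (R.H * R.env.variation R.H R.M) + R.H * (E * (S * A) * R.H) +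
        4 * (((R.H : ℝ) + 1) * √R.ι) * (√(5 * R.H) * √(E * (S * A) * R.M)) +
        R.H * √(R.M * R.ι)) +
      (1 + 1 / (R.H : ℝ)) * ∑ m ∈ Finset.range R.M, R.shortfall ω (h + 1) m := by
  have h1 : ∑ m ∈ Finset.range R.M, R.shortfall ω h m ≤
      3 * ∑ m ∈ Finset.range R.M, R.bonus (m / R.K) +
      R.H * ∑ m ∈ Finset.range R.M, (if stageIndex R.H (R.rank ω h m) = 0 then (1 : ℝ) else 0) +
      2 * (((R.H : ℝ) + 1) * √R.ι) *
        ∑ m ∈ Finset.range R.M, (if stageIndex R.H (R.rank ω h m) = 0 then (0 : ℝ)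
          else 1 / √(stageLength R.H (stageIndex R.H (R.rank ω h m) - 1) : ℝ)) +
      ∑ m ∈ Finset.range R.M,
        R.previousExcess ω h (R.st ω m h) (R.ac ω m h) (m / R.K) (R.rank ω h m) +
      R.gapDeviation h ω +
      (∑ m ∈ Finset.range R.M, R.shortfall ω (h + 1) m -
        ∑ m ∈ Finset.range R.M, R.excess ω (h + 1) m) := by
    rw [gapDeviation, Finset.mul_sum, Finset.mul_sum, Finset.mul_sum, ← Finset.sum_add_distrib,
      ← Finset.sum_add_distrib, ← Finset.sum_add_distrib, ← Finset.sum_add_distrib,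
      ← Finset.sum_sub_distrib, ← Finset.sum_add_distrib]
    refine Finset.sum_le_sum fun m hm => ?_
    refine (R.shortfall_le hh m).trans ?_
    gcongr
    exact R.Q_sub_optQ_le hH hK hω hh (Finset.mem_range.1 hm) _ _
  have h2 := R.sum_bonusDelta_le hK hE hH
  have h3 := R.sum_first_stage_le (ω := ω) hH h hE
  have h4 := R.sum_bonus_le (ω := ω) hH h hE
  have h5 := R.sum_previousExcess_le hH hK hω hh hE
  have h6 := hω.2 h hh
  have h7 : ∑ m ∈ Finset.range R.M, R.excess ω (h + 1) m ≤
      ∑ m ∈ Finset.range R.M, R.shortfall ω (h + 1) m :=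
    Finset.sum_le_sum fun m _ => sub_le_sub_left (R.env.value_le_optValue hh _ _) _
  have hH1 : (0 : ℝ) < R.H := by exact_mod_cast hH
  have h8 := mul_le_mul_of_nonneg_left h3 hH1.le
  have h9 := mul_le_mul_of_nonneg_left h4
    (show 0 ≤ 2 * (((R.H : ℝ) + 1) * √R.ι) by positivity)
  -- The excess enters with coefficient `(1 + 1/H) - 1 = 1/H`; bounding it by the shortfall gives
  -- the factor `1 + 1/H`.
  have h10 := mul_le_mul_of_nonneg_left h7 (show 0 ≤ 1 / (R.H : ℝ) by positivity)
  linarith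

theorem sum_shortfall_le [NeZero A] (hH : 0 < R.H) (hK : 0 < R.K) (hω : R.Good ω) {E : ℕ}
    (hE : ∀ m < R.M, m / R.K < E) {B : ℝ} (hB0 : 0 ≤ B)
    (hB : 6 * ((R.K : ℝ) - 1) * (R.H * R.env.variation R.H R.M) + R.H * (E * (S * A) * R.H) +
        4 * (((R.H : ℝ) + 1) * √R.ι) * (√(5 * R.H) * √(E * (S * A) * R.M)) +
        R.H * √(R.M * R.ι) ≤ B) :
    ∑ m ∈ Finset.range R.M, R.shortfall ω 0 m ≤ 3 * R.H * B := by
  have hH1 : (0 : ℝ) < R.H := by exact_mod_cast hH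
  -- Unrolling from the end of the episode, where the shortfall vanishes, adds one copy of `B` per
  -- step.
  have key : ∀ k ≤ R.H, ∑ m ∈ Finset.range R.M, R.shortfall ω (R.H - k) m ≤
      k * (1 + 1 / (R.H : ℝ)) ^ k * B := by
    intro k
    induction k with
    | zero =>
      intro _
      rw [Finset.sum_eq_zero]
      · simp
      · intro m _
        rw [shortfall, Nat.sub_zero, V_last, value_of_le _ _ _ le_rfl, sub_zero]
    | succ k ih =>
      intro hk
      have h1 := R.sum_shortfall_step hH hK hω (h := R.H - (k + 1)) (by omega) hE
      rw [show R.H - (k + 1) + 1 = R.H - k by omega] at h1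
      have h2 := mul_le_mul_of_nonneg_left (ih (by omega))
        (show 0 ≤ 1 + 1 / (R.H : ℝ) by positivity)
      have h3 : (1 : ℝ) ≤ (1 + 1 / (R.H : ℝ)) ^ (k + 1) :=
        one_le_pow₀ (by linarith [show 0 ≤ 1 / (R.H : ℝ) by positivity])
      have h4 := mul_le_mul_of_nonneg_right h3 hB0
      calc _ ≤ B + (1 + 1 / (R.H : ℝ)) * (k * (1 + 1 / (R.H : ℝ)) ^ k * B) := by linarith
        _ ≤ (1 + 1 / (R.H : ℝ)) ^ (k + 1) * B +
            (1 + 1 / (R.H : ℝ)) * (k * (1 + 1 / (R.H : ℝ)) ^ k * B) := by linarith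
        _ = _ := by push_cast; ring
  have h1 := key R.H le_rfl
  rw [Nat.sub_self] at h1
  have h2 : (1 + 1 / (R.H : ℝ)) ^ R.H ≤ 3 := by
    calc (1 + 1 / (R.H : ℝ)) ^ R.H ≤ (Real.exp (1 / (R.H : ℝ))) ^ R.H := by
          gcongr
          rw [add_comm]
          exact Real.add_one_le_exp _
      _ = Real.exp 1 := by rw [← Real.exp_nat_mul]; congr 1; field_simp
      _ ≤ 3 := by linarith [Real.exp_one_lt_d9]
  refine h1.trans ?_
  have h3 := mul_le_mul_of_nonneg_left h2 (mul_nonneg hH1.le hB0)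
  linarith

theorem regret_le [NeZero A] (hH : 0 < R.H) (hK : 0 < R.K) (hω : R.Good ω) :
    RestartQUCB.regret R.env R.g R.H R.M R.δ' R.s₁ ω ≤
      ∑ m ∈ Finset.range R.M, R.shortfall ω 0 m := by
  refine Finset.sum_le_sum fun m hm => ?_
  have h1 := R.excess_nonneg hH hK hω (Nat.zero_le _) (Finset.mem_range.1 hm)
  exact sub_le_sub_right (sub_nonneg.1 h1) _

end Run

/-! ### Balancing the terms and conclusion -/

/-- Comparison of the terms of the regret bound, in terms of the cube roots `x, y, z, t, w` of
`S A`, `Δ`, `H`, `T`, `c`. -/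
theorem regret_terms_le {x y z t w D X k E ι M : ℝ} (hx : 0 < x) (hy : 0 < y) (hz : 1 ≤ z)
    (ht : 0 < t) (hw : 0 < w) (hx1 : 1 ≤ x)
    (hD : D = y ^ 2 * t / (x * z ^ 2)) (hX : X = x * y * z ^ 5 * t ^ 2) (hD1 : 1 ≤ D)
    (hM : M * z ^ 3 = t ^ 3) (hc : w * (x * y * z ^ 2) ≤ t) (hk : k ≤ M / D) (hE : E ≤ 2 * D)
    (hι : 1 / 2 ≤ ι) :
    3 * z ^ 3 * (6 * k * (z ^ 3 * y ^ 3) + z ^ 3 * (E * x ^ 3 * z ^ 3) +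
      4 * ((z ^ 3 + 1) * √ι) * (√(5 * z ^ 3) * √(E * x ^ 3 * M)) + z ^ 3 * √(M * ι)) ≤
      (234 + 12 / w) * ι * X := by
  have hz0 : 0 < z := by linarith
  have hD0 : 0 < D := by linarith
  have hM' : M = t ^ 3 / z ^ 3 := by rw [eq_div_iff (by positivity), hM]
  have hM0 : 0 < M := by rw [hM']; positivity
  have hX0 : 0 < X := by rw [hX]; positivity
  have hz3 : 1 ≤ z ^ 3 := one_le_pow₀ hz
  have hx3 : 1 ≤ x ^ 3 := one_le_pow₀ hx1
  -- Drift term: with the prescribed `D`, inserting `M / D` gives exactly `X`.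
  have T1 : z ^ 3 * k * (z ^ 3 * y ^ 3) ≤ X := by
    calc z ^ 3 * k * (z ^ 3 * y ^ 3) ≤ z ^ 3 * (M / D) * (z ^ 3 * y ^ 3) := by gcongr
      _ = X := by rw [hX, hM', hD]; field_simp
  -- First-stage term: the only place where the lower bound on `T` enters, which is why the constant
  -- depends on `c`.
  have T2 : z ^ 3 * (z ^ 3 * (E * x ^ 3 * z ^ 3)) ≤ 2 / w * X := by
    have h1 : x * y * z ^ 2 ≤ t / w := by rw [le_div_iff₀ hw]; linarith
    calc z ^ 3 * (z ^ 3 * (E * x ^ 3 * z ^ 3)) ≤ z ^ 3 * (z ^ 3 * (2 * D * x ^ 3 * z ^ 3)) := by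
          gcongr
      _ = 2 * (x * y * z ^ 2) * (x * y * z ^ 5 * t) := by rw [hD]; field_simp
      _ ≤ 2 * (t / w) * (x * y * z ^ 5 * t) := by gcongr
      _ = _ := by rw [hX]; field_simp
  -- This identity turns both square-root terms into multiples of `X`.
  have hXX : z ^ 12 * x ^ 3 * t ^ 3 * D = X ^ 2 := by rw [hX, hD]; field_simp
  have T3 : z ^ 3 * ((z ^ 3 + 1) * (√(5 * z ^ 3) * √(E * x ^ 3 * M))) ≤ 8 * X := by
    have h1 : √(5 * z ^ 3) * √(E * x ^ 3 * M) ≤ 4 * X / z ^ 6 := by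
      rw [← Real.sqrt_mul (by positivity)]
      refine Real.sqrt_le_iff.2 ⟨by positivity, ?_⟩
      calc 5 * z ^ 3 * (E * x ^ 3 * M) ≤ 5 * z ^ 3 * (2 * D * x ^ 3 * M) := by gcongr
        _ = 10 * X ^ 2 / z ^ 12 := by rw [← hXX, hM']; field_simp; norm_num
        _ ≤ 16 * X ^ 2 / z ^ 12 := by gcongr; norm_num
        _ = _ := by ring
    calc _ ≤ z ^ 3 * ((z ^ 3 + z ^ 3) * (4 * X / z ^ 6)) := by gcongr
      _ = 8 * X := by field_simp; norm_num
  have T4 : z ^ 3 * (z ^ 3 * √M) ≤ X := by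
    have h1 : √M ≤ X / z ^ 6 := by
      refine Real.sqrt_le_iff.2 ⟨by positivity, ?_⟩
      have h2 : 1 ≤ x ^ 3 * z ^ 3 * D :=
        one_le_mul_of_one_le_of_one_le (one_le_mul_of_one_le_of_one_le hx3 hz3) hD1
      calc M ≤ M * (x ^ 3 * z ^ 3 * D) := le_mul_of_one_le_right hM0.le h2
        _ = _ := by rw [div_pow, ← hXX, hM']; field_simp
    calc _ ≤ z ^ 3 * (z ^ 3 * (X / z ^ 6)) := by gcongr
      _ = X := by field_simp
  -- Since `ι ≥ 1/2`, both `1` and `√ι` are at most `2 ι`, so a single power of the logarithm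
  -- suffices.
  have hs : √ι ≤ 2 * ι := Real.sqrt_le_iff.2 ⟨by linarith, by nlinarith⟩
  have hs0 : 0 ≤ √ι := Real.sqrt_nonneg _
  rw [Real.sqrt_mul hM0.le]
  have U3 := mul_le_mul_of_nonneg_left T3 hs0
  have U4 := mul_le_mul_of_nonneg_left T4 hs0
  have V : √ι * X ≤ 2 * ι * X := mul_le_mul_of_nonneg_right hs hX0.le
  have W : X ≤ 2 * ι * X := le_mul_of_one_le_left hX0.le (by linarith)
  have W2 : 1 / w * X ≤ 1 / w * (2 * ι * X) := mul_le_mul_of_nonneg_left W (by positivity)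
  calc _ = 18 * (z ^ 3 * k * (z ^ 3 * y ^ 3)) + 3 * (z ^ 3 * (z ^ 3 * (E * x ^ 3 * z ^ 3))) +
        12 * (√ι * (z ^ 3 * ((z ^ 3 + 1) * (√(5 * z ^ 3) * √(E * x ^ 3 * M))))) +
        3 * (√ι * (z ^ 3 * (z ^ 3 * √M))) := by ring
    _ ≤ 18 * X + 3 * (2 / w * X) + 12 * (√ι * (8 * X)) + 3 * (√ι * X) := by gcongr
    _ = 18 * X + 6 * (1 / w * X) + 99 * (√ι * X) := by ring
    _ ≤ 18 * (2 * ι * X) + 6 * (1 / w * (2 * ι * X)) + 99 * (2 * ι * X) := by gcongr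
    _ = _ := by ring

theorem rpow_third_pow {x : ℝ} (hx : 0 ≤ x) : (x ^ (1 / 3 : ℝ)) ^ 3 = x := by
  rw [← Real.rpow_natCast, ← Real.rpow_mul hx]; norm_num

theorem rpow_eq_third_pow {x : ℝ} (hx : 0 ≤ x) (n : ℕ) {r : ℝ} (hr : r = n / 3) :
    x ^ r = (x ^ (1 / 3 : ℝ)) ^ n := by
  rw [← Real.rpow_natCast, ← Real.rpow_mul hx, hr]; congr 1; ring

theorem NonstationaryMDP.variation_nonneg {S A : ℕ} (env : NonstationaryMDP S A) (H M : ℕ) :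
    0 ≤ env.variation H M :=
  add_nonneg (Finset.sum_nonneg fun _ _ => env.rewardStep_nonneg _ _)
    (Finset.sum_nonneg fun _ _ => env.transStep_nonneg _ _)

/-- `D` carries the factor `Δ^(2/3)`, so it would vanish with `Δ`. -/
theorem NonstationaryMDP.variation_pos {S A : ℕ} {env : NonstationaryMDP S A} {H M : ℕ}
    (hD : 1 ≤ env.epochs H M) : 0 < env.variation H M := by
  refine (env.variation_nonneg H M).lt_of_ne fun h => ?_
  rw [epochs, ← h, Real.zero_rpow (by norm_num)] at hD
  norm_num at hD

/-- The regret bound on the good event. -/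
theorem Run.regret_le_of_good {S A : ℕ} (R : Run S A) (hS : 0 < S) (hA : 0 < A) (hH : 0 < R.H)
    (hM : 0 < R.M) {c : ℝ} (hc0 : 0 < c)
    (hc : c * ((S : ℝ) * A * R.env.variation R.H R.M * (R.H : ℝ) ^ 2) ≤ (R.M : ℝ) * R.H)
    (hD : 1 ≤ R.env.epochs R.H R.M) (hι : 1 / 2 ≤ R.ι)
    {ω : ℕ × ℕ × Fin S × Fin A → ℝ × Fin S} (hω : R.Good ω) :
    RestartQUCB.regret R.env R.g R.H R.M R.δ' R.s₁ ω ≤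
      (234 + 12 / c ^ (1 / 3 : ℝ)) * R.ι * ((S : ℝ) ^ (1 / 3 : ℝ) * (A : ℝ) ^ (1 / 3 : ℝ) *
        R.env.variation R.H R.M ^ (1 / 3 : ℝ) * (R.H : ℝ) ^ (5 / 3 : ℝ) *
          ((R.M : ℝ) * R.H) ^ (2 / 3 : ℝ)) := by
  have : NeZero A := ⟨hA.ne'⟩
  have hS1 : (1 : ℝ) ≤ S := by exact_mod_cast hS
  have hA1 : (1 : ℝ) ≤ A := by exact_mod_cast hA
  have hH1 : (1 : ℝ) ≤ R.H := by exact_mod_cast hH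
  have hM1 : (1 : ℝ) ≤ R.M := by exact_mod_cast hM
  have hΔ := NonstationaryMDP.variation_pos hD
  set Δ := R.env.variation R.H R.M with hΔdef
  set D := R.env.epochs R.H R.M with hDdef
  have hD0 : 0 < D := by linarith
  have hMD : 0 < (R.M : ℝ) / D := by positivity
  have hKdef : R.K = ⌈(R.M : ℝ) / D⌉₊ := rfl
  have hK : 0 < R.K := hKdef ▸ Nat.ceil_pos.2 hMD
  have hK0 : (0 : ℝ) < R.K := by exact_mod_cast hK
  have hK1 : (R.K : ℝ) - 1 ≤ R.M / D := by
    rw [hKdef]; linarith [Nat.ceil_lt_add_one hMD.le]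
  have hK2 : (R.M : ℝ) / D ≤ R.K := hKdef ▸ Nat.le_ceil _
  have hE : ∀ m < R.M, m / R.K < R.M / R.K + 1 := fun m hm =>
    Nat.lt_succ_of_le (Nat.div_le_div_right hm.le)
  -- There are at most `M / K + 1 ≤ D + 1` epochs, and `D ≥ 1` absorbs the extra one.
  have hE2 : ((R.M / R.K + 1 : ℕ) : ℝ) ≤ 2 * D := by
    have h1 : ((R.M / R.K : ℕ) : ℝ) ≤ R.M / R.K := Nat.cast_div_le
    have h2 : (R.M : ℝ) / R.K ≤ D := by
      rw [div_le_iff₀ hK0]; rw [div_le_iff₀ hD0] at hK2; linarith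
    push_cast
    linarith
  have hSA : (1 : ℝ) ≤ (S : ℝ) * A := one_le_mul_of_one_le_of_one_le hS1 hA1
  have hT0 : (0 : ℝ) < (R.M : ℝ) * R.H := by positivity
  have hX : (S : ℝ) ^ (1 / 3 : ℝ) * (A : ℝ) ^ (1 / 3 : ℝ) *
        Δ ^ (1 / 3 : ℝ) * (R.H : ℝ) ^ (5 / 3 : ℝ) * ((R.M : ℝ) * R.H) ^ (2 / 3 : ℝ) =
      ((S : ℝ) * A) ^ (1 / 3 : ℝ) * Δ ^ (1 / 3 : ℝ) * ((R.H : ℝ) ^ (1 / 3 : ℝ)) ^ 5 *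
        (((R.M : ℝ) * R.H) ^ (1 / 3 : ℝ)) ^ 2 := by
    rw [← Real.mul_rpow (by positivity) (by positivity),
      rpow_eq_third_pow (x := (R.H : ℝ)) (by positivity) 5 (r := 5 / 3) (by norm_num),
      rpow_eq_third_pow (x := (R.M : ℝ) * R.H) (by positivity) 2 (r := 2 / 3) (by norm_num)]
  have hDx : D = (Δ ^ (1 / 3 : ℝ)) ^ 2 * ((R.M : ℝ) * R.H) ^ (1 / 3 : ℝ) /
      (((S : ℝ) * A) ^ (1 / 3 : ℝ) * ((R.H : ℝ) ^ (1 / 3 : ℝ)) ^ 2) := by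
    rw [hDdef, NonstationaryMDP.epochs, ← Real.mul_rpow (by positivity) (by positivity),
      Real.rpow_neg (by positivity), Real.rpow_neg (by positivity),
      rpow_eq_third_pow (x := (R.H : ℝ)) (by positivity) 2 (r := 2 / 3) (by norm_num),
      rpow_eq_third_pow hΔ.le 2 (r := 2 / 3) (by norm_num)]
    field_simp
  have hcube : c ^ (1 / 3 : ℝ) * (((S : ℝ) * A) ^ (1 / 3 : ℝ) * Δ ^ (1 / 3 : ℝ) *
      ((R.H : ℝ) ^ (1 / 3 : ℝ)) ^ 2) ≤ ((R.M : ℝ) * R.H) ^ (1 / 3 : ℝ) := by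
    refine le_of_pow_le_pow_left₀ (n := 3) (by norm_num) (by positivity) ?_
    rw [mul_pow, mul_pow, mul_pow, ← pow_mul, mul_comm 2 3, pow_mul, rpow_third_pow hc0.le,
      rpow_third_pow (by positivity), rpow_third_pow hΔ.le, rpow_third_pow (by positivity),
      rpow_third_pow hT0.le]
    exact hc
  have hb := regret_terms_le (x := ((S : ℝ) * A) ^ (1 / 3 : ℝ)) (y := Δ ^ (1 / 3 : ℝ))
    (z := (R.H : ℝ) ^ (1 / 3 : ℝ)) (t := ((R.M : ℝ) * R.H) ^ (1 / 3 : ℝ))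
    (w := c ^ (1 / 3 : ℝ)) (M := R.M) (ι := R.ι) (by positivity) (by positivity)
    (Real.one_le_rpow hH1 (by norm_num)) (by positivity) (by positivity)
    (Real.one_le_rpow hSA (by norm_num)) hDx rfl hD
    (by rw [rpow_third_pow (by positivity), rpow_third_pow hT0.le]) hcube hK1 hE2 hι
  rw [rpow_third_pow (by positivity), rpow_third_pow hΔ.le, rpow_third_pow (by positivity)] at hb
  rw [hX]
  refine (R.regret_le hH hK hω).trans ((R.sum_shortfall_le hH hK hω hE ?_ le_rfl).trans hb)
  have hK3 : (1 : ℝ) ≤ R.K := by exact_mod_cast hK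
  have : 0 ≤ (R.K : ℝ) - 1 := by linarith
  have : 0 ≤ R.ι := by linarith
  positivity

/-- The good event fails with probability at most `δ`. -/
theorem Run.noise_not_good_le_confidence {S A : ℕ} (R : Run S A) (hS : 0 < S) (hA : 0 < A)
    (hH : 0 < R.H) (hM : 0 < R.M) {δ : ℝ} (hδ : 0 < δ) (hδ1 : δ < 1)
    (hR : R.δ' = δ / ((S : ℝ) * A * ((R.M : ℝ) * R.H))) (hι : 0 < R.ι) :
    R.env.noise {ω | ¬ R.Good ω} ≤ ENNReal.ofReal δ := by
  have : NeZero A := ⟨hA.ne'⟩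
  refine (R.noise_not_good_le hM hι).trans (ENNReal.ofReal_le_ofReal ?_)
  have hS1 : (1 : ℝ) ≤ S := by exact_mod_cast hS
  have hA1 : (1 : ℝ) ≤ A := by exact_mod_cast hA
  have hH1 : (1 : ℝ) ≤ R.H := by exact_mod_cast hH
  have hM1 : (1 : ℝ) ≤ R.M := by exact_mod_cast hM
  have hT : (0 : ℝ) < (S : ℝ) * A * ((R.M : ℝ) * R.H) := by positivity
  -- The tail is quadratic in `δ'`, of size `(δ / (2 S A T))²`; this pays for a union over at most
  -- `3 (S A T)²` events, leaving `3 δ² / 4 ≤ δ`.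
  have hexp : Real.exp (-(2 * R.ι)) = (δ / ((S : ℝ) * A * ((R.M : ℝ) * R.H)) / 2) ^ 2 := by
    rw [ι, hR, Real.exp_neg, two_mul, Real.exp_add, Real.exp_log (by positivity)]
    field_simp
  have h1 : (S : ℝ) * A * R.H * R.M * R.M ≤ ((S : ℝ) * A * ((R.M : ℝ) * R.H)) ^ 2 := by
    calc (S : ℝ) * A * R.H * R.M * R.M ≤ (S : ℝ) * A * R.H * R.M * R.M * (S * A * R.H) :=
          le_mul_of_one_le_right (by positivity) (one_le_mul_of_one_le_of_one_le
            (one_le_mul_of_one_le_of_one_le hS1 hA1) hH1)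
      _ = _ := by ring
  have h2 : (R.H : ℝ) ≤ (S : ℝ) * A * R.H * R.M * R.M := by
    calc (R.H : ℝ) ≤ R.H * (S * A * R.M * R.M) :=
          le_mul_of_one_le_right (by positivity) (one_le_mul_of_one_le_of_one_le
            (one_le_mul_of_one_le_of_one_le (one_le_mul_of_one_le_of_one_le hS1 hA1) hM1) hM1)
      _ = _ := by ring
  have h3 : ((2 * (S * A * R.H * R.M * R.M) + R.H : ℕ) : ℝ) ≤
      3 * ((S : ℝ) * A * ((R.M : ℝ) * R.H)) ^ 2 := by
    push_cast
    linarith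
  rw [hexp]
  calc _ ≤ 3 * ((S : ℝ) * A * ((R.M : ℝ) * R.H)) ^ 2 *
        (δ / ((S : ℝ) * A * ((R.M : ℝ) * R.H)) / 2) ^ 2 := by gcongr
    _ = 3 / 4 * δ ^ 2 := by field_simp; norm_num
    _ ≤ δ := by nlinarith

end

theorem mainTheorem2 :
    ∃ p : ℕ, ∀ c : ℝ, 0 < c → ∃ C : ℝ, 0 < C ∧
      ∀ (S A H M : ℕ), 0 < S → 0 < A → 0 < H → 0 < M →
      ∀ (env : NonstationaryMDP S A) (g : GreedyRule S A) (s₁ : ℕ → Fin S) (δ : ℝ),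
        0 < δ → δ < 1 →
        c * ((S : ℝ) * A * env.variation H M * (H : ℝ) ^ 2) ≤ (M : ℝ) * H →
        1 ≤ env.epochs H M →
        ENNReal.ofReal (1 - δ) ≤
          env.noise {ω |
            RestartQUCB.regret env g H M (δ / ((S : ℝ) * A * ((M : ℝ) * H))) s₁ ω ≤
              C * Real.log (2 * ((S : ℝ) * A * ((M : ℝ) * H)) / δ) ^ p *
                ((S : ℝ) ^ (1 / 3 : ℝ) * (A : ℝ) ^ (1 / 3 : ℝ) *
                  env.variation H M ^ (1 / 3 : ℝ) * (H : ℝ) ^ (5 / 3 : ℝ) *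
                  ((M : ℝ) * H) ^ (2 / 3 : ℝ))} := by
  refine ⟨1, fun c hc0 => ⟨234 + 12 / c ^ (1 / 3 : ℝ), by positivity, ?_⟩⟩
  intro S A H M hS hA hH hM env g s₁ δ hδ hδ1 hc hD
  let R : Run S A := ⟨env, g, H, M, δ / ((S : ℝ) * A * ((M : ℝ) * H)), s₁⟩
  have hT : (1 : ℝ) ≤ (S : ℝ) * A * ((M : ℝ) * H) := by
    exact_mod_cast Nat.mul_pos (Nat.mul_pos hS hA) (Nat.mul_pos hM hH)
  have hιeq : R.ι = Real.log (2 * ((S : ℝ) * A * ((M : ℝ) * H)) / δ) := by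
    simp only [Run.ι, R, div_div_eq_mul_div]
  have hι : 1 / 2 ≤ R.ι := by
    -- `S A T ≥ 1` and `δ < 1` give `ι ≥ log 2`, which exceeds `1/2`.
    have h1 : Real.log 2 ≤ R.ι := by
      rw [hιeq]
      refine Real.log_le_log (by norm_num) ?_
      rw [le_div_iff₀ hδ]
      nlinarith
    linarith [Real.log_two_gt_d9]
  have hbad := R.noise_not_good_le_confidence hS hA hH hM hδ hδ1 rfl (by linarith)
  have hsub : {ω | R.Good ω} ⊆ {ω |
      RestartQUCB.regret env g H M (δ / ((S : ℝ) * A * ((M : ℝ) * H))) s₁ ω ≤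
        (234 + 12 / c ^ (1 / 3 : ℝ)) * Real.log (2 * ((S : ℝ) * A * ((M : ℝ) * H)) / δ) ^ 1 *
          ((S : ℝ) ^ (1 / 3 : ℝ) * (A : ℝ) ^ (1 / 3 : ℝ) *
            env.variation H M ^ (1 / 3 : ℝ) * (H : ℝ) ^ (5 / 3 : ℝ) *
            ((M : ℝ) * H) ^ (2 / 3 : ℝ))} := by
    intro ω hω
    have h := R.regret_le_of_good hS hA hH hM hc0 hc hD hι hω
    rw [hιeq] at h
    rw [pow_one]
    exact h
  refine le_trans ?_ (measure_mono hsub)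
  -- Subadditivity of the measure suffices here, so `Good` need not be shown measurable.
  rw [ENNReal.ofReal_sub _ hδ.le, ENNReal.ofReal_one, tsub_le_iff_right]
  calc (1 : ENNReal) = env.noise Set.univ := measure_univ.symm
    _ ≤ env.noise ({ω | R.Good ω} ∪ {ω | ¬ R.Good ω}) :=
        measure_mono fun ω _ => Classical.em (R.Good ω)
    _ ≤ env.noise {ω | R.Good ω} + env.noise {ω | ¬ R.Good ω} := measure_union_le _ _
    _ ≤ env.noise {ω | R.Good ω} + ENNReal.ofReal δ := by gcongr
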